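/- Let $\mathcal D$ be the set of pairs $(u,F)$ of functions on $\mathbb R$ such that $u\in L^\infty(\mathbb R)$ (represented by its continuous representative), $u_x\in L^2(\mathbb R)$ in the weak sense, $F\in L^\infty(\mathbb R)$ is increasing and left continuous, $\lim_{x\to-\infty}F(x)=0$, $\|F\|_\infty=F_\infty$, and $\int_a^b u_x^2\,dx\le F(b^-)-F(a^+)$ for all $a<b$; here $F_\infty>0$ is fixed. For $\Delta x>0$ put $x_j=j\Delta x$ $(j\in\mathbb Z)$, $\Delta t=\sqrt{\Delta x}/(2\sqrt{F_\infty})$ and $t^n=n\Delta t$. Let $\mathbb P_{\Delta x}(u,F)$ be the pair of continuous functions that agree with $u$, $F$ at all $x_j$ and are linear in between. For continuous $(U,G)$ that is linear between neighbouring grid points and $0\le\tau\le\Delta t$, let $T_\tau(U,G)=(\tilde U,\tilde G)$ be the pair that is linear between the neighbouring points $x_j(\tau)=x_j+U(x_j)\tau+\frac14\left(G(x_j)-\frac12F_\infty\right)\tau^2$ and satisfies $\tilde U(x_j(\tau))=U(x_j)+\frac12\left(G(x_j)-\frac12F_\infty\right)\tau$, $\tilde G(x_j(\tau))=G(x_j)$.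 For initial data $(u_0,F_0)\in\mathcal D$ set $(U^0,F^0)=\mathbb P_{\Delta x}(u_0,F_0)$, $(U^{n+1},F^{n+1})=\mathbb P_{\Delta x}T_{\Delta t}(U^n,F^n)$, and define the numerical solution by $(u_{\Delta x},F_{\Delta x})(t,\cdot)=\mathbb P_{\Delta x}T_\tau(U^n,F^n)$ for $t=t^n+\tau$, $\tau\in[0,\Delta t)$. Theorem. Let $(u_0,F_0)\in\mathcal D$, let $\mu_0$ be the finite positive Radon measure with $F_0(x)=\mu_0((-\infty,x))$, and assume that $\mu_0$ has compact support. Then every sequence of positive mesh sizes $\Delta x\to0$ has a subsequence along which $(u_{\Delta x},F_{\Delta x})$ converges to a pair $(u,F)$ of functions on $[0,\infty)\times\mathbb R$ in the following sense: for every $T>0$, $u_{\Delta x}\to u$ uniformly on $[0,T]\times\mathbb R$ and $F_{\Delta x}\to F$ in $C([0,T],L^1(\mathbb R))$ (that is, $\sup_{t\in[0,T]}\|F_{\Delta x}(t)-F(t)\|_{L^1}\to0$, where $F_{\Delta x}$ and $F$ are continuous in $t$ for the $L^1$ distance); and for every $t\ge0$, $F_{\Delta x}(t,x)\to F(t,x)$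 for almost every $x$. Moreover $u|_{t=0}=u_0$, $F|_{t=0}=F_0$, $u\in C^{0,1/2}([0,T]\times\mathbb R)$ for every $T>0$, and $(u(t),F(t))\in\mathcal D$ and $\|F(t)\|_\infty=F_\infty$ for all $t\ge0$. -/

import Mathlib

open MeasureTheory Filter Topology Set
open scoped ContDiff NNReal ENNReal

namespace HunterSaxton

noncomputable section

/-- `v` is the weak derivative of `u` on the real line. -/
def HasWeakDeriv (u v : ℝ → ℝ) : Prop :=
  LocallyIntegrable u volume ∧ LocallyIntegrable v volume ∧
    ∀ φ : ℝ → ℝ, ContDiff ℝ ∞ φ → HasCompactSupport φ →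
      ∫ x, u x * deriv φ x = - ∫ x, v x * φ x

/-- The space `𝒟` of pairs `(u, F)` with total energy `‖F‖_∞ = Finf`.
Since `u_x ∈ L²`, the class `u` has a continuous representative, and `u` denotes that one:
it is the one that is evaluated at grid points. -/
structure MemD (Finf : ℝ) (u F : ℝ → ℝ) : Prop where
  continuous_u : Continuous u
  u_memLp : MemLp u ∞ volume
  F_memLp : MemLp F ∞ volume
  F_mono : Monotone F
  F_leftCont : ∀ x, ContinuousWithinAt F (Iic x) x
  F_atBot : Tendsto F atBot (𝓝 0)
  F_norm : (eLpNorm F ∞ volume).toReal = Finf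
  energy : ∃ ux : ℝ → ℝ, HasWeakDeriv u ux ∧ MemLp ux 2 volume ∧
    ∀ a b : ℝ, a < b → ∫ x in a..b, ux x ^ 2 ≤ Function.leftLim F b - Function.rightLim F a

/-- The index `j` with `X j ≤ x < X (j + 1)`, for nodes `X` that increase strictly from `-∞`
to `+∞`. -/
def nodeIndex (X : ℤ → ℝ) (x : ℝ) : ℤ := sSup {j : ℤ | X j ≤ x}

/-- The continuous piecewise linear function with value `V j` at the node `X j`. -/
def interp (X V : ℤ → ℝ) (x : ℝ) : ℝ :=
  V (nodeIndex X x) +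
    (x - X (nodeIndex X x)) / (X (nodeIndex X x + 1) - X (nodeIndex X x)) *
      (V (nodeIndex X x + 1) - V (nodeIndex X x))

/-- The grid point `x_j = j Δx`. -/
def gridPt (dx : ℝ) (j : ℤ) : ℝ := (j : ℝ) * dx

/-- The projection `ℙ_Δx`: linear interpolation of the values at the grid points. -/
def proj (dx : ℝ) (w : (ℝ → ℝ) × (ℝ → ℝ)) : (ℝ → ℝ) × (ℝ → ℝ) :=
  (interp (gridPt dx) fun j => w.1 (gridPt dx j),
   interp (gridPt dx) fun j => w.2 (gridPt dx j))

/-- Position at time `t` of the breakpoint that starts at the grid point `x_j` and travels along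
its characteristic. -/
def breakPt (dx Finf t : ℝ) (w : (ℝ → ℝ) × (ℝ → ℝ)) (j : ℤ) : ℝ :=
  gridPt dx j + w.1 (gridPt dx j) * t + 1 / 4 * (w.2 (gridPt dx j) - 1 / 2 * Finf) * t ^ 2

/-- The solution operator `T_t` on continuous data `w` that is piecewise linear with breakpoints
in the grid, for times before wave breaking: the values are transported along the
characteristics of the breakpoints, with linear interpolation between the moved breakpoints. -/
def evolve (dx Finf t : ℝ) (w : (ℝ → ℝ) × (ℝ → ℝ)) : (ℝ → ℝ) × (ℝ → ℝ) :=
  (interp (breakPt dx Finf t w) fun j =>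
      w.1 (gridPt dx j) + 1 / 2 * (w.2 (gridPt dx j) - 1 / 2 * Finf) * t,
   interp (breakPt dx Finf t w) fun j => w.2 (gridPt dx j))

/-- The time step `Δt = √Δx / (2 √F_∞)`. -/
def timeStep (dx Finf : ℝ) : ℝ := √dx / (2 * √Finf)

/-- The pairs `(Uⁿ, Fⁿ)` of the scheme. -/
def scheme (dx Finf : ℝ) (w₀ : (ℝ → ℝ) × (ℝ → ℝ)) : ℕ → (ℝ → ℝ) × (ℝ → ℝ)
  | 0 => proj dx w₀
  | n + 1 => proj dx (evolve dx Finf (timeStep dx Finf) (scheme dx Finf w₀ n))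

/-- The numerical solution at time `t = tⁿ + τ`, `0 ≤ τ < Δt`: the pair `ℙ_Δx T_τ (Uⁿ, Fⁿ)`. -/
def numSol (dx Finf : ℝ) (w₀ : (ℝ → ℝ) × (ℝ → ℝ)) (t : ℝ) : (ℝ → ℝ) × (ℝ → ℝ) :=
  proj dx (evolve dx Finf (t - (⌊t / timeStep dx Finf⌋₊ : ℝ) * timeStep dx Finf)
    (scheme dx Finf w₀ ⌊t / timeStep dx Finf⌋₊))

/-- The numerical approximation `u_Δx` for the initial data `(u₀, F₀)`. -/
def uNum (Finf : ℝ) (u₀ F₀ : ℝ → ℝ) (dx t x : ℝ) : ℝ := (numSol dx Finf (u₀, F₀) t).1 x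

/-- The numerical approximation `F_Δx` for the initial data `(u₀, F₀)`. -/
def FNum (Finf : ℝ) (u₀ F₀ : ℝ → ℝ) (dx t x : ℝ) : ℝ := (numSol dx Finf (u₀, F₀) t).2 x

/-- `t ↦ G t` is continuous on `[0, T]` for the `L¹` distance. The functions `G t` themselves
need not be integrable (here they tend to `F_∞ > 0` at `+∞`), only their differences. -/
def ContL1 (T : ℝ) (G : ℝ → ℝ → ℝ) : Prop :=
  ∀ s ∈ Icc 0 T, (∀ t ∈ Icc 0 T, Integrable (fun x => G t x - G s x) volume) ∧
    Tendsto (fun t => eLpNorm (fun x => G t x - G s x) 1 volume) (𝓝[Icc 0 T] s) (𝓝 0)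

/-- Convergence in `C([0, T], L¹(ℝ))`. -/
def TendstoCL1 (T : ℝ) (G : ℕ → ℝ → ℝ → ℝ) (F : ℝ → ℝ → ℝ) : Prop :=
  (∀ k, ContL1 T (G k)) ∧ ContL1 T F ∧
  (∀ k, ∀ t ∈ Icc 0 T, Integrable (fun x => G k t x - F t x) volume) ∧
  Tendsto (fun k => ⨆ t ∈ Icc 0 T, eLpNorm (fun x => G k t x - F t x) 1 volume) atTop (𝓝 0)

end

end HunterSaxton

namespace HunterSaxton


/-! The argument is a compactness proof in the spirit of Arzelà–Ascoli and Helly. Its invariant is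
the pointwise energy condition `EnergyPair`: `F` increases and `(u b - u a)² ≤ (b - a) (F b - F a)`.
For bounded data it makes `u` Hölder-1/2 in space with constant `√Finf`. Linear interpolation
preserves it (`energyPair_interp`), and so does the flow (`IsState.evolve`), because on each cell
the increments satisfy an exact algebraic identity. The time step satisfies `Δx = 4 Finf Δt²`, so
moved breakpoints stay at least `Δx / 2` apart.

Regularity in time is measured horizontally. One step moves values of `F` by `O(Δt)` in space
(`GClose`); values of `u` move equally far and change by `O(Δt)` (`UClose`), since the projection
error `√(Finf Δx)` equals `2 Finf Δt`. Summed over the steps this is proportional to the elapsed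
time, and the horizontal displacement of `u` becomes a vertical error only at the end, through the
Hölder bound. The result, `numSol_close`, is equicontinuity up to an error that vanishes with the
mesh.

`IsApprox` records what compactness needs: the energy condition, this modulus, and `F` constant
outside a fixed interval on each `[0, T]`. A subsequence converges at rational points. For `u`
equicontinuity extends this to all points, uniformly; for `F` the candidate limit is the left
continuous `lowerLimit`, attained at its continuity points. Profiles within a horizontal shift `δ`
differ by at most `2 δ Finf` in `L¹`, which gives convergence uniformly in time.

The set `𝒟` enters at both ends. `MemD.energyPair` derives the pointwise condition from the weak one
by Cauchy–Schwarz. `memD_of_energyPair` returns to `𝒟`: the pointwise condition makes `u` absolutely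
continuous with `u_x² ≤ F'` almost everywhere, and `∫ F'` is at most the increment of `F` between
one-sided limits. -/

/-! ### Piecewise linear interpolation on a bi-infinite set of nodes -/

/-- Nodes that increase strictly from `-∞` to `+∞`. -/
structure IsNodes (X : ℤ → ℝ) : Prop where
  strictMono : StrictMono X
  exists_le : ∀ x, ∃ j, X j ≤ x
  exists_gt : ∀ x, ∃ j, x < X j

theorem IsNodes.nodeIndex_spec {X : ℤ → ℝ} (hX : IsNodes X) (x : ℝ) :
    X (nodeIndex X x) ≤ x ∧ x < X (nodeIndex X x + 1) := by
  obtain ⟨k, hk⟩ := hX.exists_gt x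
  have hb : BddAbove {j : ℤ | X j ≤ x} :=
    ⟨k, fun j hj => (hX.strictMono.lt_iff_lt.1 (lt_of_le_of_lt hj hk)).le⟩
  have hmem : nodeIndex X x ∈ {j : ℤ | X j ≤ x} := Int.csSup_mem (hX.exists_le x) hb
  refine ⟨hmem, ?_⟩
  by_contra h
  have : nodeIndex X x + 1 ≤ nodeIndex X x := le_csSup hb (not_lt.1 h)
  omega

theorem IsNodes.nodeIndex_eq {X : ℤ → ℝ} (hX : IsNodes X) {x : ℝ} {j : ℤ} (h₁ : X j ≤ x)
    (h₂ : x < X (j + 1)) : nodeIndex X x = j := by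
  obtain ⟨h₃, h₄⟩ := hX.nodeIndex_spec x
  have h₅ := hX.strictMono.lt_iff_lt.1 (lt_of_le_of_lt h₁ h₄)
  have h₆ := hX.strictMono.lt_iff_lt.1 (lt_of_le_of_lt h₃ h₂)
  omega

theorem IsNodes.exists_cell {X : ℤ → ℝ} (hX : IsNodes X) (x : ℝ) :
    ∃ j, X j ≤ x ∧ x < X (j + 1) :=
  ⟨_, hX.nodeIndex_spec x⟩

theorem IsNodes.lt_succ {X : ℤ → ℝ} (hX : IsNodes X) (j : ℤ) : X j < X (j + 1) :=
  hX.strictMono (lt_add_one j)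

theorem interp_of_mem {X : ℤ → ℝ} (hX : IsNodes X) (V : ℤ → ℝ) {x : ℝ} {j : ℤ} (h₁ : X j ≤ x)
    (h₂ : x ≤ X (j + 1)) :
    interp X V x = V j + (x - X j) / (X (j + 1) - X j) * (V (j + 1) - V j) := by
  rcases h₂.lt_or_eq with h | rfl
  · rw [interp, hX.nodeIndex_eq h₁ h]
  · have h' := hX.lt_succ (j + 1)
    have h'' := hX.lt_succ j
    rw [interp, hX.nodeIndex_eq le_rfl h', div_self (by linarith)]
    simp

theorem interp_node {X : ℤ → ℝ} (hX : IsNodes X) (V : ℤ → ℝ) (j : ℤ) :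
    interp X V (X j) = V j := by
  rw [interp_of_mem hX V le_rfl (hX.lt_succ j).le]
  simp

/-- On each cell the interpolant is a convex combination of the neighbouring values. -/
theorem exists_interp_weight {X : ℤ → ℝ} (hX : IsNodes X) (x : ℝ) :
    ∃ j θ, 0 ≤ θ ∧ θ ≤ 1 ∧ X j ≤ x ∧ x < X (j + 1) ∧ x = (1 - θ) * X j + θ * X (j + 1) ∧
      ∀ V, interp X V x = (1 - θ) * V j + θ * V (j + 1) := by
  obtain ⟨j, h₁, h₂⟩ := hX.exists_cell x
  have h := hX.lt_succ j
  have hpos : 0 < X (j + 1) - X j := by linarith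
  refine ⟨j, (x - X j) / (X (j + 1) - X j), by apply div_nonneg <;> linarith,
    (div_le_one hpos).2 (by linarith), h₁, h₂, ?_, fun V => ?_⟩
  · field_simp; ring
  · rw [interp_of_mem hX V h₁ h₂.le]; ring

theorem interp_convex_comb {X : ℤ → ℝ} (hX : IsNodes X) (V : ℤ → ℝ) (j : ℤ) {θ : ℝ} (h₀ : 0 ≤ θ)
    (h₁ : θ ≤ 1) :
    interp X V ((1 - θ) * X j + θ * X (j + 1)) = (1 - θ) * V j + θ * V (j + 1) := by
  have h := hX.lt_succ j
  have hpos : 0 < X (j + 1) - X j := by linarith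
  rw [interp_of_mem hX V (j := j) (by nlinarith) (by nlinarith)]
  field_simp; ring

/-- A relation that is transitive along increasing triples and holds within the cells of a family
of nodes holds for all ordered pairs. -/
theorem IsNodes.rel_of_cells {X : ℤ → ℝ} (hX : IsNodes X) {r : ℝ → ℝ → Prop}
    (htrans : ∀ a b c, a ≤ b → b ≤ c → r a b → r b c → r a c)
    (hcell : ∀ j a b, X j ≤ a → a ≤ b → b ≤ X (j + 1) → r a b) {a b : ℝ} (hab : a ≤ b) :
    r a b := by
  -- Induction on the number `n` of further cells. The cell of `a` is taken closed on the right, so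
  -- that the induction can restart at a node.
  have key : ∀ (n : ℕ) (j : ℤ) (a b : ℝ), X j ≤ a → a ≤ X (j + 1) → a ≤ b →
      b ≤ X (j + 1 + n) → r a b := by
    intro n
    induction n with
    | zero => intro j a b h₁ h₂ h₃ h₄; exact hcell j a b h₁ h₃ (by simpa using h₄)
    | succ n ih =>
      intro j a b h₁ h₂ h₃ h₄
      rcases le_total b (X (j + 1)) with h | h
      · exact hcell j a b h₁ h₃ h
      · refine htrans a _ b h₂ h (hcell j _ _ h₁ h₂ le_rfl) ?_
        refine ih (j + 1) _ b le_rfl (hX.lt_succ _).le h ?_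
        convert h₄ using 2
        push_cast; ring
  obtain ⟨i, hi, hi'⟩ := hX.exists_cell a
  obtain ⟨k, hk⟩ := hX.exists_gt b
  refine key (k - (i + 1)).toNat i a b hi hi'.le hab (hk.le.trans (hX.strictMono.monotone ?_))
  have := Int.self_le_toNat (k - (i + 1))
  omega

/-! ### The pointwise energy condition -/

/-- The pointwise form of the condition `∫ₐᵇ u_x² ≤ F b - F a`. -/
def EnergyPair (u F : ℝ → ℝ) : Prop :=
  ∀ a b, a ≤ b → F a ≤ F b ∧ (u b - u a) ^ 2 ≤ (b - a) * (F b - F a)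

theorem EnergyPair.monotone {u F : ℝ → ℝ} (h : EnergyPair u F) : Monotone F :=
  fun a b hab => (h a b hab).1

/-- Cauchy–Schwarz for two terms. It makes the energy condition pass from adjacent intervals to
their union, so that it need only be checked within cells. -/
theorem sq_add_le_mul_add {p q a b A B : ℝ} (ha : 0 ≤ a) (hb : 0 ≤ b) (hA : 0 ≤ A) (hB : 0 ≤ B)
    (h₁ : p ^ 2 ≤ a * A) (h₂ : q ^ 2 ≤ b * B) : (p + q) ^ 2 ≤ (a + b) * (A + B) := by
  have h₃ : (p * q) ^ 2 ≤ (a * B) * (b * A) := by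
    calc (p * q) ^ 2 = p ^ 2 * q ^ 2 := by ring
      _ ≤ (a * A) * (b * B) := by gcongr
      _ = _ := by ring
  have h₄ : 2 * (p * q) ≤ a * B + b * A := by
    have : (2 * (p * q)) ^ 2 ≤ (a * B + b * A) ^ 2 := by nlinarith [sq_nonneg (a * B - b * A)]
    exact (le_abs_self _).trans (abs_le_of_sq_le_sq this (by positivity))
  nlinarith

/-- Within a cell both interpolants are affine, so both sides of the inequality scale by the square
of the fraction of the cell. The condition at neighbouring nodes is therefore enough. -/
theorem energyPair_interp {X U G : ℤ → ℝ} (hX : IsNodes X) (hG : ∀ j, G j ≤ G (j + 1))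
    (hU : ∀ j, (U (j + 1) - U j) ^ 2 ≤ (X (j + 1) - X j) * (G (j + 1) - G j)) :
    EnergyPair (interp X U) (interp X G) := by
  intro a b hab
  refine hX.rel_of_cells (r := fun a b => interp X G a ≤ interp X G b ∧
    (interp X U b - interp X U a) ^ 2 ≤ (b - a) * (interp X G b - interp X G a)) ?_ ?_ hab
  · rintro a b c hab hbc ⟨h₁, h₂⟩ ⟨h₃, h₄⟩
    refine ⟨h₁.trans h₃, ?_⟩
    have := sq_add_le_mul_add (sub_nonneg.2 hab) (sub_nonneg.2 hbc) (sub_nonneg.2 h₁)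
      (sub_nonneg.2 h₃) h₂ h₄
    convert this using 1 <;> ring
  · intro j a b h₁ h₂ h₃
    have hpos : 0 < X (j + 1) - X j := by linarith [hX.lt_succ j]
    rw [interp_of_mem hX G h₁ (h₂.trans h₃), interp_of_mem hX G (h₁.trans h₂) h₃,
      interp_of_mem hX U h₁ (h₂.trans h₃), interp_of_mem hX U (h₁.trans h₂) h₃]
    constructor
    · have := hG j
      gcongr
    · have e₁ : ∀ V₀ W : ℝ, V₀ + (b - X j) / (X (j + 1) - X j) * W -
          (V₀ + (a - X j) / (X (j + 1) - X j) * W) = (b - a) / (X (j + 1) - X j) * W :=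
        fun V₀ W => by ring
      rw [e₁, e₁]
      calc ((b - a) / (X (j + 1) - X j) * (U (j + 1) - U j)) ^ 2
          = ((b - a) / (X (j + 1) - X j)) ^ 2 * (U (j + 1) - U j) ^ 2 := by ring
        _ ≤ ((b - a) / (X (j + 1) - X j)) ^ 2 * ((X (j + 1) - X j) * (G (j + 1) - G j)) := by
          gcongr; exact hU j
        _ = _ := by field_simp

theorem interp_mem_Icc {X V : ℤ → ℝ} (hX : IsNodes X) {m M : ℝ} (h : ∀ j, V j ∈ Icc m M) (x : ℝ) :
    interp X V x ∈ Icc m M := by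
  obtain ⟨j, θ, h₀, h₁, -, -, -, hV⟩ := exists_interp_weight hX x
  rw [hV]
  have a := h j
  have b := h (j + 1)
  constructor <;> nlinarith [a.1, a.2, b.1, b.2]

theorem abs_interp_sub_interp_le {X V W : ℤ → ℝ} (hX : IsNodes X) {K : ℝ}
    (h : ∀ j, |V j - W j| ≤ K) (x : ℝ) : |interp X V x - interp X W x| ≤ K := by
  obtain ⟨j, θ, h₀, h₁, -, -, -, hV⟩ := exists_interp_weight hX x
  rw [hV, hV]
  have a := abs_le.1 (h j)
  have b := abs_le.1 (h (j + 1))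
  rw [abs_le]
  constructor <;> nlinarith [a.1, a.2, b.1, b.2]

/-- An interpolant with node distances at least `h` and jumps at most `A` is Lipschitz. -/
theorem abs_interp_sub_le {X V : ℤ → ℝ} (hX : IsNodes X) {h A : ℝ} (hh : 0 < h)
    (hXh : ∀ j, h ≤ X (j + 1) - X j) (hV : ∀ j, |V (j + 1) - V j| ≤ A) (x y : ℝ) :
    |interp X V x - interp X V y| ≤ A / h * |x - y| := by
  have hA : 0 ≤ A := (abs_nonneg _).trans (hV 0)
  wlog hyx : y ≤ x generalizing x y
  · rw [abs_sub_comm, abs_sub_comm x]; exact this y x (le_of_not_ge hyx)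
  rw [abs_of_nonneg (sub_nonneg.2 hyx)]
  refine hX.rel_of_cells (r := fun a b => |interp X V b - interp X V a| ≤ A / h * (b - a))
    ?_ ?_ hyx
  · intro a b c _ _ h₁ h₂
    calc _ ≤ _ := abs_sub_le _ (interp X V b) _
      _ ≤ _ := add_le_add h₂ h₁
      _ = _ := by ring
  · intro j a b h₁ h₂ h₃
    have hpos : 0 < X (j + 1) - X j := by linarith [hX.lt_succ j]
    rw [interp_of_mem hX V h₁ (h₂.trans h₃), interp_of_mem hX V (h₁.trans h₂) h₃]
    have e₁ : V j + (b - X j) / (X (j + 1) - X j) * (V (j + 1) - V j) -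
        (V j + (a - X j) / (X (j + 1) - X j) * (V (j + 1) - V j)) =
        (b - a) / (X (j + 1) - X j) * (V (j + 1) - V j) := by ring
    have hba : 0 ≤ b - a := by linarith
    rw [e₁, abs_mul, abs_of_nonneg (div_nonneg hba hpos.le)]
    calc _ ≤ (b - a) / h * A := by
          gcongr
          · exact hXh j
          · exact hV j
      _ = _ := by ring

theorem isNodes_of_increment_ge {X : ℤ → ℝ} {h : ℝ} (hh : 0 < h)
    (hX : ∀ j, h ≤ X (j + 1) - X j) : IsNodes X := by
  have hm : StrictMono X := strictMono_int_of_lt_succ fun j => by linarith [hX j]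
  have hup : ∀ n : ℕ, X 0 + n * h ≤ X n := by
    intro n
    induction n with
    | zero => simp
    | succ n ih => have := hX n; push_cast; linarith
  have hdn : ∀ n : ℕ, X (-n) ≤ X 0 - n * h := by
    intro n
    induction n with
    | zero => simp
    | succ n ih =>
      have := hX (-(n + 1 : ℕ))
      have e : (-((n + 1 : ℕ) : ℤ)) + 1 = -n := by push_cast; ring
      rw [e] at this
      push_cast at this ⊢
      linarith
  refine ⟨hm, fun x => ?_, fun x => ?_⟩
  · obtain ⟨n, hn⟩ := exists_nat_gt ((X 0 - x) / h)
    rw [div_lt_iff₀ hh] at hn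
    exact ⟨-n, by linarith [hdn n]⟩
  · obtain ⟨n, hn⟩ := exists_nat_gt ((x - X 0) / h)
    rw [div_lt_iff₀ hh] at hn
    exact ⟨n, by linarith [hup n]⟩

theorem gridPt_succ (dx : ℝ) (j : ℤ) : gridPt dx (j + 1) = gridPt dx j + dx := by
  simp only [gridPt]; push_cast; ring

theorem isNodes_gridPt {dx : ℝ} (hdx : 0 < dx) : IsNodes (gridPt dx) :=
  isNodes_of_increment_ge hdx fun j => by rw [gridPt_succ]; linarith


/-! ### One time step: no wave breaking, invariance, transport -/

theorem timeStep_pos {dx Finf : ℝ} (hdx : 0 < dx) (hF : 0 < Finf) : 0 < timeStep dx Finf := by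
  unfold timeStep; positivity

theorem four_mul_timeStep_sq {dx Finf : ℝ} (hdx : 0 < dx) (hF : 0 < Finf) :
    4 * Finf * timeStep dx Finf ^ 2 = dx := by
  have h₁ := Real.sq_sqrt hdx.le
  have h₂ := Real.sq_sqrt hF.le
  rw [timeStep, div_pow, mul_pow, h₁, h₂]
  field_simp; norm_num

/-- The Hölder oscillation of `u` over one cell is of order `Δt`. Projection errors therefore add up
to a multiple of the elapsed time. -/
theorem sqrt_mul_eq_timeStep {dx Finf : ℝ} (hdx : 0 < dx) (hF : 0 < Finf) :
    √(Finf * dx) = 2 * Finf * timeStep dx Finf := by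
  have h := timeStep_pos hdx hF
  rw [Real.sqrt_eq_iff_mul_self_eq (by positivity) (by positivity)]
  linear_combination -Finf * four_mul_timeStep_sq hdx hF

/-- Pairs with the energy condition, total energy at most `Finf` and `|u| ≤ M`. -/
structure IsState (Finf M : ℝ) (w : (ℝ → ℝ) × (ℝ → ℝ)) : Prop where
  energy : EnergyPair w.1 w.2
  mem_Icc : ∀ x, w.2 x ∈ Icc 0 Finf
  abs_fst_le : ∀ x, |w.1 x| ≤ M

theorem IsState.abs_sub_le {Finf M : ℝ} {w : (ℝ → ℝ) × (ℝ → ℝ)} (hw : IsState Finf M w)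
    {x y d : ℝ} (h : |x - y| ≤ d) : |w.1 x - w.1 y| ≤ √(Finf * d) := by
  wlog hyx : y ≤ x generalizing x y
  · rw [abs_sub_comm]; exact this (by rwa [abs_sub_comm]) (le_of_not_ge hyx)
  obtain ⟨h₁, h₂⟩ := hw.energy y x hyx
  rw [abs_of_nonneg (sub_nonneg.2 hyx)] at h
  refine Real.abs_le_sqrt (h₂.trans ?_)
  have h₃ := (hw.mem_Icc x).2
  have h₄ := (hw.mem_Icc y).1
  calc _ ≤ d * Finf := mul_le_mul h (by linarith) (by linarith) (by linarith)
    _ = _ := mul_comm _ _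

/-- The velocity difference of neighbours is at most `√(Finf Δx) = 2 Finf Δt`, so it closes the gap
by at most `2 Finf Δt² = Δx / 2`. The quadratic term only widens the gap, since `F` increases. -/
theorem IsState.half_le_breakPt_sub {dx Finf M τ : ℝ} {w : (ℝ → ℝ) × (ℝ → ℝ)} (hdx : 0 < dx)
    (hF : 0 < Finf) (hw : IsState Finf M w) (hτ₀ : 0 ≤ τ) (hτ : τ ≤ timeStep dx Finf) (j : ℤ) :
    dx / 2 ≤ breakPt dx Finf τ w (j + 1) - breakPt dx Finf τ w j := by
  have h := hw.energy (gridPt dx j) (gridPt dx (j + 1)) (by rw [gridPt_succ]; linarith)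
  have e : gridPt dx (j + 1) - gridPt dx j = dx := by rw [gridPt_succ]; ring
  rw [e] at h
  have h₃ := (hw.mem_Icc (gridPt dx (j + 1))).2
  have h₄ := (hw.mem_Icc (gridPt dx j)).1
  simp only [breakPt]
  set a := w.1 (gridPt dx (j + 1))
  set b := w.1 (gridPt dx j)
  set g := w.2 (gridPt dx (j + 1))
  set f := w.2 (gridPt dx j)
  have hτ2 : Finf * τ ^ 2 ≤ dx / 4 := by
    have : τ ^ 2 ≤ timeStep dx Finf ^ 2 := by gcongr
    have h5 := four_mul_timeStep_sq hdx hF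
    nlinarith
  have h6 : ((a - b) * τ) ^ 2 ≤ (dx / 2) ^ 2 := by
    calc ((a - b) * τ) ^ 2 = (a - b) ^ 2 * τ ^ 2 := by ring
      _ ≤ dx * (g - f) * τ ^ 2 := by gcongr; exact h.2
      _ ≤ dx * Finf * τ ^ 2 := by gcongr; linarith
      _ = dx * (Finf * τ ^ 2) := by ring
      _ ≤ dx * (dx / 4) := by gcongr
      _ = _ := by ring
  have h7 := (abs_le.1 (abs_le_of_sq_le_sq h6 (by positivity))).1
  have h8 : 0 ≤ (g - f) * τ ^ 2 := mul_nonneg (by linarith) (sq_nonneg _)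
  nlinarith

theorem IsState.isNodes_breakPt {dx Finf M τ : ℝ} {w : (ℝ → ℝ) × (ℝ → ℝ)} (hdx : 0 < dx)
    (hF : 0 < Finf) (hw : IsState Finf M w) (hτ₀ : 0 ≤ τ) (hτ : τ ≤ timeStep dx Finf) :
    IsNodes (breakPt dx Finf τ w) :=
  isNodes_of_increment_ge (half_pos hdx) fun j => hw.half_le_breakPt_sub hdx hF hτ₀ hτ j

theorem IsState.proj {dx Finf M : ℝ} {w : (ℝ → ℝ) × (ℝ → ℝ)} (hdx : 0 < dx)
    (hw : IsState Finf M w) : IsState Finf M (proj dx w) where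
  energy := by
    have hg : ∀ j, gridPt dx j ≤ gridPt dx (j + 1) := fun j => by rw [gridPt_succ]; linarith
    simp only [HunterSaxton.proj]
    exact energyPair_interp (isNodes_gridPt hdx) (fun j => (hw.energy _ _ (hg j)).1)
      (fun j => (hw.energy _ _ (hg j)).2)
  mem_Icc := interp_mem_Icc (isNodes_gridPt hdx) fun j => hw.mem_Icc _
  abs_fst_le x := abs_le.2 (interp_mem_Icc (isNodes_gridPt hdx) (fun j => abs_le.1 (hw.abs_fst_le _)) x)

/-- With `p`, `g` the increments of `u`, `F` over a cell, `(p + g τ / 2)² = p² + g (p τ + g τ² /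
4)`, and `p τ + g τ² / 4` is exactly the change in the width of the cell. Hence `p² ≤ Δx g` becomes
the same inequality for the moved cell. The bound on `|u|` grows at rate `Finf / 4` because `|F -
Finf / 2| ≤ Finf / 2`. -/
theorem IsState.evolve {dx Finf M τ : ℝ} {w : (ℝ → ℝ) × (ℝ → ℝ)} (hdx : 0 < dx)
    (hF : 0 < Finf) (hw : IsState Finf M w) (hτ₀ : 0 ≤ τ) (hτ : τ ≤ timeStep dx Finf) :
    IsState Finf (M + 1 / 4 * Finf * τ) (evolve dx Finf τ w) where
  energy := by
    have hg : ∀ j, w.2 (gridPt dx j) ≤ w.2 (gridPt dx (j + 1)) ∧ _ := fun j =>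
      hw.energy (gridPt dx j) (gridPt dx (j + 1)) (by rw [gridPt_succ]; linarith)
    simp only [HunterSaxton.evolve]
    refine energyPair_interp (hw.isNodes_breakPt hdx hF hτ₀ hτ) (fun j => (hg j).1) fun j => ?_
    have h₁ := (hg j).2
    have h₂ : breakPt dx Finf τ w (j + 1) - breakPt dx Finf τ w j =
        (gridPt dx (j + 1) - gridPt dx j) + (w.1 (gridPt dx (j + 1)) - w.1 (gridPt dx j)) * τ +
          1 / 4 * (w.2 (gridPt dx (j + 1)) - w.2 (gridPt dx j)) * τ ^ 2 := by
      simp only [breakPt]; ring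
    rw [h₂]
    nlinarith
  mem_Icc := interp_mem_Icc (hw.isNodes_breakPt hdx hF hτ₀ hτ) fun j => hw.mem_Icc _
  abs_fst_le x := by
    simp only [HunterSaxton.evolve]
    refine abs_le.2 (interp_mem_Icc (hw.isNodes_breakPt hdx hF hτ₀ hτ) (fun j => ?_) x)
    have h₁ := abs_le.1 (hw.abs_fst_le (gridPt dx j))
    have h₂ := hw.mem_Icc (gridPt dx j)
    constructor <;> nlinarith [h₁.1, h₁.2, h₂.1, h₂.2]

theorem proj_proj {dx : ℝ} (hdx : 0 < dx) (w : (ℝ → ℝ) × (ℝ → ℝ)) :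
    proj dx (proj dx w) = proj dx w := by
  simp only [proj, interp_node (isNodes_gridPt hdx)]

theorem evolve_zero (dx Finf : ℝ) (w : (ℝ → ℝ) × (ℝ → ℝ)) : evolve dx Finf 0 w = proj dx w := by
  have : breakPt dx Finf 0 w = gridPt dx := by funext j; simp [breakPt]
  simp [evolve, proj, this]

/-- Values are transported along characteristics. -/
theorem IsState.exists_evolve_eq {dx Finf M τ τ' h : ℝ} {w : (ℝ → ℝ) × (ℝ → ℝ)} (hdx : 0 < dx)
    (hF : 0 < Finf) (hw : IsState Finf M w) (hτ₀ : 0 ≤ τ) (hτ : τ ≤ h) (hτ₀' : 0 ≤ τ')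
    (hτ' : τ' ≤ h) (hh : h ≤ timeStep dx Finf) (x : ℝ) :
    ∃ x', |x' - x| ≤ (M + 1 / 4 * Finf * h) * |τ' - τ| ∧
      (HunterSaxton.evolve dx Finf τ' w).2 x' = (HunterSaxton.evolve dx Finf τ w).2 x ∧
      |(HunterSaxton.evolve dx Finf τ' w).1 x' - (HunterSaxton.evolve dx Finf τ w).1 x| ≤
        1 / 4 * Finf * |τ' - τ| := by
  have hX := hw.isNodes_breakPt hdx hF hτ₀ (hτ.trans hh)
  have hX' := hw.isNodes_breakPt hdx hF hτ₀' (hτ'.trans hh)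
  obtain ⟨j, θ, h₀, h₁, -, -, hx, hV⟩ := exists_interp_weight hX x
  have conv : ∀ {a b K : ℝ}, |a| ≤ K → |b| ≤ K → |(1 - θ) * a + θ * b| ≤ K := by
    intro a b K ha hb
    rw [abs_le] at *
    constructor <;> nlinarith
  have hG : ∀ i, |w.2 (gridPt dx i) - 1 / 2 * Finf| ≤ 1 / 2 * Finf := fun i => by
    have := hw.mem_Icc (gridPt dx i)
    rw [abs_le]; constructor <;> linarith [this.1, this.2]
  -- The point with the same barycentric coordinate `θ` in the moved cell: both interpolants carry
  -- their values along with it.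
  refine ⟨(1 - θ) * breakPt dx Finf τ' w j + θ * breakPt dx Finf τ' w (j + 1), ?_, ?_, ?_⟩
  · have hb : ∀ i, |breakPt dx Finf τ' w i - breakPt dx Finf τ w i| ≤
        (M + 1 / 4 * Finf * h) * |τ' - τ| := fun i => by
      have e : breakPt dx Finf τ' w i - breakPt dx Finf τ w i = (w.1 (gridPt dx i) +
          1 / 4 * (w.2 (gridPt dx i) - 1 / 2 * Finf) * (τ' + τ)) * (τ' - τ) := by
        simp only [breakPt]; ring
      rw [e, abs_mul]
      gcongr
      refine (abs_add_le _ _).trans (add_le_add (hw.abs_fst_le _) ?_)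
      rw [abs_mul, abs_mul, abs_of_nonneg (by linarith : 0 ≤ τ' + τ)]
      have := hG i
      calc _ ≤ |(1 / 4 : ℝ)| * (1 / 2 * Finf) * (2 * h) := by gcongr; linarith
        _ = _ := by rw [abs_of_pos (by norm_num)]; ring
    rw [hx]
    convert conv (hb j) (hb (j + 1)) using 2
    ring
  · simp only [HunterSaxton.evolve]
    rw [interp_convex_comb hX' _ _ h₀ h₁, hV]
  · simp only [HunterSaxton.evolve]
    rw [interp_convex_comb hX' _ _ h₀ h₁, hV]
    have hb : ∀ i, |1 / 2 * (w.2 (gridPt dx i) - 1 / 2 * Finf) * (τ' - τ)| ≤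
        1 / 4 * Finf * |τ' - τ| := fun i => by
      rw [abs_mul, abs_mul]
      have := hG i
      calc _ ≤ |(1 / 2 : ℝ)| * (1 / 2 * Finf) * |τ' - τ| := by gcongr
        _ = _ := by rw [abs_of_pos (by norm_num)]; ring
    convert conv (hb j) (hb (j + 1)) using 2
    ring

/-! ### Closeness up to horizontal displacement -/

/-- `G'` lies between the translates of `G` by `δ`. -/
def GClose (δ : ℝ) (G G' : ℝ → ℝ) : Prop := ∀ x, G (x - δ) ≤ G' x ∧ G' x ≤ G (x + δ)

/-- Every value of `U` is attained up to `η` by `U'` at distance at most `δ`. -/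
def UClose (δ η : ℝ) (U U' : ℝ → ℝ) : Prop := ∀ x, ∃ x', |x' - x| ≤ δ ∧ |U' x' - U x| ≤ η

theorem GClose.symm {δ : ℝ} {G G' : ℝ → ℝ} (h : GClose δ G G') : GClose δ G' G := fun x => by
  have h₁ := (h (x - δ)).2
  have h₂ := (h (x + δ)).1
  simp only [sub_add_cancel, add_sub_cancel_right] at h₁ h₂
  exact ⟨h₁, h₂⟩

theorem GClose.trans {δ δ' : ℝ} {G G' G'' : ℝ → ℝ} (h : GClose δ G G') (h' : GClose δ' G' G'') :
    GClose (δ + δ') G G'' := fun x => by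
  constructor
  · have := (h (x - δ')).1
    rw [show x - δ' - δ = x - (δ + δ') by ring] at this
    exact this.trans (h' x).1
  · have := (h (x + δ')).2
    rw [show x + δ' + δ = x + (δ + δ') by ring] at this
    exact (h' x).2.trans this

theorem GClose.mono {δ δ' : ℝ} {G G' : ℝ → ℝ} (hG : Monotone G) (h : GClose δ G G')
    (hδ : δ ≤ δ') : GClose δ' G G' := fun x =>
  ⟨(hG (by linarith)).trans (h x).1, (h x).2.trans (hG (by linarith))⟩

theorem UClose.trans {δ δ' η η' : ℝ} {U U' U'' : ℝ → ℝ} (h : UClose δ η U U')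
    (h' : UClose δ' η' U' U'') : UClose (δ + δ') (η + η') U U'' := fun x => by
  obtain ⟨y, h₁, h₂⟩ := h x
  obtain ⟨z, h₃, h₄⟩ := h' y
  refine ⟨z, ?_, ?_⟩
  · linarith [abs_sub_le z y x]
  · linarith [abs_sub_le (U'' z) (U' y) (U x)]

theorem UClose.mono {δ δ' η η' : ℝ} {U U' : ℝ → ℝ} (h : UClose δ η U U') (hδ : δ ≤ δ')
    (hη : η ≤ η') : UClose δ' η' U U' := fun x => by
  obtain ⟨y, h₁, h₂⟩ := h x
  exact ⟨y, h₁.trans hδ, h₂.trans hη⟩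

/-- Trades horizontal displacement for a vertical error by the Hölder bound. This should happen
once, after chaining the steps: a loss of order `√Δt` in each of about `T / Δt` steps would diverge.
-/
theorem UClose.abs_sub_le {δ η Finf M : ℝ} {U : ℝ → ℝ} {w : (ℝ → ℝ) × (ℝ → ℝ)}
    (h : UClose δ η U w.1) (hw : IsState Finf M w) (x : ℝ) :
    |w.1 x - U x| ≤ η + √(Finf * δ) := by
  obtain ⟨y, h₁, h₂⟩ := h x
  have h₃ := hw.abs_sub_le (x := x) (y := y) (d := δ) (by rwa [abs_sub_comm])
  linarith [_root_.abs_sub_le (w.1 x) (w.1 y) (U x)]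

theorem gClose_proj {dx : ℝ} (hdx : 0 < dx) {w : (ℝ → ℝ) × (ℝ → ℝ)} (hw : Monotone w.2) :
    GClose dx w.2 (proj dx w).2 := fun x => by
  obtain ⟨j, θ, h₀, h₁, h₂, h₃, hx, hV⟩ := exists_interp_weight (isNodes_gridPt hdx) x
  simp only [proj]
  rw [hV]
  have e := gridPt_succ dx j
  have a₁ : w.2 (x - dx) ≤ w.2 (gridPt dx j) := hw (by linarith)
  have a₂ : w.2 (gridPt dx j) ≤ w.2 (gridPt dx (j + 1)) := hw (by linarith)
  have a₃ : w.2 (gridPt dx (j + 1)) ≤ w.2 (x + dx) := hw (by linarith)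
  constructor <;> nlinarith

theorem IsState.abs_proj_sub_le {dx Finf M : ℝ} {w : (ℝ → ℝ) × (ℝ → ℝ)} (hdx : 0 < dx)
    (hw : IsState Finf M w) (x : ℝ) :
    |(HunterSaxton.proj dx w).1 x - w.1 x| ≤ √(Finf * dx) := by
  obtain ⟨j, θ, h₀, h₁, h₂, h₃, hx, hV⟩ := exists_interp_weight (isNodes_gridPt hdx) x
  simp only [HunterSaxton.proj]
  rw [hV]
  have e := gridPt_succ dx j
  have a₁ := abs_le.1 (hw.abs_sub_le (x := gridPt dx j) (y := x) (d := dx)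
    (by rw [abs_le]; constructor <;> linarith))
  have a₂ := abs_le.1 (hw.abs_sub_le (x := gridPt dx (j + 1)) (y := x) (d := dx)
    (by rw [abs_le]; constructor <;> linarith))
  rw [abs_le]
  constructor <;> nlinarith [a₁.1, a₁.2, a₂.1, a₂.2]

/-! ### The iterated scheme -/

section Scheme

variable {dx Finf M : ℝ} {w : (ℝ → ℝ) × (ℝ → ℝ)}

theorem isState_scheme (hdx : 0 < dx) (hF : 0 < Finf) (hw : IsState Finf M w) (n : ℕ) :
    IsState Finf (M + 1 / 4 * Finf * (n * timeStep dx Finf)) (scheme dx Finf w n) := by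
  induction n with
  | zero => simpa [scheme] using hw.proj hdx
  | succ n ih =>
    have := (ih.evolve hdx hF (timeStep_pos hdx hF).le le_rfl).proj hdx
    rw [scheme]
    convert this using 1
    push_cast; ring

theorem proj_scheme (hdx : 0 < dx) (n : ℕ) :
    proj dx (scheme dx Finf w n) = scheme dx Finf w n := by
  cases n <;> simp only [scheme, proj_proj hdx]

/-- The formula also holds at the right endpoint of a time step, since `T_0` is the projection and
the projection is idempotent. Thus nothing jumps at the times `tⁿ`. -/
theorem numSol_of_mem (hdx : 0 < dx) (hF : 0 < Finf) {t : ℝ} {n : ℕ}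
    (h₁ : n * timeStep dx Finf ≤ t) (h₂ : t ≤ (n + 1) * timeStep dx Finf) :
    numSol dx Finf w t =
      proj dx (evolve dx Finf (t - n * timeStep dx Finf) (scheme dx Finf w n)) := by
  have hp := timeStep_pos hdx hF
  rcases h₂.lt_or_eq with h | h
  · have : ⌊t / timeStep dx Finf⌋₊ = n := by
      have h₀ : 0 ≤ t := le_trans (by positivity) h₁
      rw [Nat.floor_eq_iff (by positivity), le_div_iff₀ hp, div_lt_iff₀ hp]
      exact ⟨h₁, h⟩
    rw [numSol, this]
  · have : ⌊t / timeStep dx Finf⌋₊ = n + 1 := by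
      rw [h, mul_div_cancel_right₀ _ hp.ne']
      exact_mod_cast Nat.floor_natCast (n + 1)
    rw [numSol, this, h]
    have e₁ : ((n : ℝ) + 1) * timeStep dx Finf - ((n + 1 : ℕ) : ℝ) * timeStep dx Finf = 0 := by
      push_cast; ring
    have e₂ : ((n : ℝ) + 1) * timeStep dx Finf - n * timeStep dx Finf = timeStep dx Finf := by ring
    rw [e₁, e₂, evolve_zero, proj_proj hdx, proj_scheme hdx, scheme]

end Scheme

/-! ### Modulus of continuity in time -/

section TimeModulus

variable {dx Finf M : ℝ} {w : (ℝ → ℝ) × (ℝ → ℝ)}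

theorem exists_step (hdx : 0 < dx) (hF : 0 < Finf) {t : ℝ} (ht : 0 ≤ t) :
    ∃ n : ℕ, n * timeStep dx Finf ≤ t ∧ t ≤ (n + 1) * timeStep dx Finf := by
  have hp := timeStep_pos hdx hF
  refine ⟨⌊t / timeStep dx Finf⌋₊, ?_, ?_⟩
  · rw [← le_div_iff₀ hp]; exact Nat.floor_le (by positivity)
  · rw [← div_le_iff₀ hp]; exact (Nat.lt_floor_add_one _).le

theorem isState_numSol (hdx : 0 < dx) (hF : 0 < Finf) (hw : IsState Finf M w) {t : ℝ}
    (ht : 0 ≤ t) : IsState Finf (M + 1 / 4 * Finf * t) (numSol dx Finf w t) := by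
  obtain ⟨n, h₁, h₂⟩ := exists_step hdx hF ht
  rw [numSol_of_mem hdx hF h₁ h₂]
  convert ((isState_scheme hdx hF hw n).evolve hdx hF (sub_nonneg.2 h₁) (by linarith)).proj hdx
    using 1
  ring

/-- One (possibly partial) time step. -/
theorem close_step (hdx : 0 < dx) (hF : 0 < Finf) (hw : IsState Finf M w) {n : ℕ} {τ T : ℝ}
    (hτ₀ : 0 ≤ τ) (hτ : τ ≤ timeStep dx Finf) (hT : n * timeStep dx Finf + τ ≤ T) :
    GClose ((M + 1 / 4 * Finf * T + 4 * Finf * timeStep dx Finf) * timeStep dx Finf)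
        (scheme dx Finf w n).2 (proj dx (evolve dx Finf τ (scheme dx Finf w n))).2 ∧
      UClose ((M + 1 / 4 * Finf * T) * timeStep dx Finf) (9 / 4 * Finf * timeStep dx Finf)
        (scheme dx Finf w n).1 (proj dx (evolve dx Finf τ (scheme dx Finf w n))).1 := by
  have hp := timeStep_pos hdx hF
  have hS := isState_scheme hdx hF hw n
  have hE := hS.evolve hdx hF hτ₀ hτ
  have hM : 0 ≤ M := (abs_nonneg _).trans (hw.abs_fst_le 0)
  have hn : 0 ≤ n * timeStep dx Finf := by positivity
  have hTF : 1 / 4 * Finf * (n * timeStep dx Finf + τ) ≤ 1 / 4 * Finf * T := by gcongr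
  have hTF0 : 0 ≤ 1 / 4 * Finf * (n * timeStep dx Finf + τ) := by positivity
  -- Transport from time `0`, where the evolved state is the grid state itself, to time `τ`.
  have key := hS.exists_evolve_eq hdx hF (le_refl 0) hτ₀ hτ₀ le_rfl hτ
  simp only [evolve_zero, proj_scheme hdx, sub_zero, abs_of_nonneg hτ₀] at key
  have hδ : (M + 1 / 4 * Finf * (n * timeStep dx Finf) + 1 / 4 * Finf * τ) * τ ≤
      (M + 1 / 4 * Finf * T) * timeStep dx Finf := by
    apply mul_le_mul _ hτ hτ₀ (by linarith)
    linarith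
  constructor
  · have h₁ : GClose ((M + 1 / 4 * Finf * T) * timeStep dx Finf)
        (scheme dx Finf w n).2 (evolve dx Finf τ (scheme dx Finf w n)).2 := by
      refine GClose.symm fun x => ?_
      obtain ⟨x', h₁, h₂, -⟩ := key x
      rw [← h₂]
      have := abs_le.1 (h₁.trans hδ)
      exact ⟨hE.energy.monotone (by linarith), hE.energy.monotone (by linarith)⟩
    convert h₁.trans (gClose_proj hdx hE.energy.monotone) using 1
    -- The projection shifts `F` by at most `Δx`, which is `4 Finf Δt · Δt`.
    linear_combination four_mul_timeStep_sq hdx hF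
  · intro x
    obtain ⟨x', h₁, -, h₂⟩ := key x
    refine ⟨x', h₁.trans hδ, ?_⟩
    -- The constant `9/4` is `1/4` from the change along characteristics plus `2` from the
    -- projection.
    have h₃ := hE.abs_proj_sub_le hdx x'
    rw [sqrt_mul_eq_timeStep hdx hF] at h₃
    have h₄ : 1 / 4 * Finf * τ ≤ 1 / 4 * Finf * timeStep dx Finf := by gcongr
    linarith [abs_sub_le ((proj dx (evolve dx Finf τ (scheme dx Finf w n))).1 x')
      ((evolve dx Finf τ (scheme dx Finf w n)).1 x') ((scheme dx Finf w n).1 x)]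

/-- All errors grow linearly in `m`, hence in the elapsed time `m Δt`. They need not vanish with the
mesh; equicontinuity is all that is required of them. -/
theorem close_scheme (hdx : 0 < dx) (hF : 0 < Finf) (hw : IsState Finf M w) {n m : ℕ} {T : ℝ}
    (hT : (n + m : ℕ) * timeStep dx Finf ≤ T) :
    GClose (m * ((M + 1 / 4 * Finf * T + 4 * Finf * timeStep dx Finf) * timeStep dx Finf))
        (scheme dx Finf w n).2 (scheme dx Finf w (n + m)).2 ∧
      UClose (m * ((M + 1 / 4 * Finf * T) * timeStep dx Finf))
        (m * (9 / 4 * Finf * timeStep dx Finf))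
        (scheme dx Finf w n).1 (scheme dx Finf w (n + m)).1 := by
  have hp := timeStep_pos hdx hF
  induction m with
  | zero => exact ⟨fun x => by simp, fun x => ⟨x, by simp⟩⟩
  | succ m ih =>
    push_cast at hT
    have h₁ := ih (by push_cast; nlinarith)
    have h₂ := close_step hdx hF hw (n := n + m) hp.le le_rfl (T := T) (by push_cast; linarith)
    rw [← add_assoc, scheme]
    push_cast
    simp only [add_mul, one_mul] at h₁ h₂ ⊢
    exact ⟨h₁.1.trans h₂.1, h₁.2.trans h₂.2⟩

/-- The modulus of continuity in time of the numerical solutions. -/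
theorem numSol_close (hdx : 0 < dx) (hF : 0 < Finf) (hw : IsState Finf M w) {s t T : ℝ}
    (hs : 0 ≤ s) (hst : s ≤ t) (htT : t ≤ T) :
    GClose (3 * ((M + 1 / 4 * Finf * T + 4 * Finf * timeStep dx Finf) *
        (t - s + timeStep dx Finf))) (numSol dx Finf w s).2 (numSol dx Finf w t).2 ∧
      ∀ x, |(numSol dx Finf w t).1 x - (numSol dx Finf w s).1 x| ≤
        3 * (9 / 4 * Finf * (t - s + timeStep dx Finf) +
          √(Finf * ((M + 1 / 4 * Finf * T) * (t - s + timeStep dx Finf)))) := by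
  have hp := timeStep_pos hdx hF
  have hM : 0 ≤ M := (abs_nonneg _).trans (hw.abs_fst_le 0)
  have ht : 0 ≤ t := hs.trans hst
  obtain ⟨n, hn₁, hn₂⟩ : ∃ n : ℕ, n * timeStep dx Finf ≤ s ∧ s ≤ (n + 1) * timeStep dx Finf :=
    exists_step hdx hF hs
  obtain ⟨k, hk₁, hk₂, hnk⟩ : ∃ k : ℕ, k * timeStep dx Finf ≤ t ∧
      t ≤ (k + 1) * timeStep dx Finf ∧ n ≤ k := by
    obtain ⟨k, hk₁, hk₂⟩ := exists_step hdx hF ht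
    rcases le_total n k with h | h
    · exact ⟨k, hk₁, hk₂, h⟩
    -- Here `t` is still in the step of `s`, because `t ≤ (k + 1) Δt ≤ (n + 1) Δt`.
    · refine ⟨n, hn₁.trans hst, hk₂.trans ?_, le_rfl⟩
      gcongr
  obtain ⟨m, rfl⟩ := Nat.exists_eq_add_of_le hnk
  set h := timeStep dx Finf
  have hm : m * h ≤ t - s + h := by push_cast at hk₁; nlinarith
  have hsT := hst.trans htT
  -- Three legs join `s` to `t`: back to `tⁿ`, along whole steps to `tⁿ⁺ᵐ`, and forward to `t`. This
  -- is the source of the factor `3`.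
  have h₁ := close_step hdx hF hw (n := n) (sub_nonneg.2 hn₁) (by linarith : s - n * h ≤ h)
    (T := T) (by simp only [h]; linarith)
  have h₂ := close_scheme hdx hF hw (hk₁.trans htT)
  have h₃ := close_step hdx hF hw (n := n + m) (sub_nonneg.2 hk₁)
    (by linarith : t - (n + m : ℕ) * h ≤ h) (T := T) (by simp only [h]; linarith)
  have hSs := isState_numSol hdx hF hw hs
  have hSt := isState_numSol hdx hF hw ht
  have hS := isState_scheme hdx hF hw (n + m)
  rw [← numSol_of_mem hdx hF hn₁ hn₂] at h₁
  rw [← numSol_of_mem hdx hF hk₁ hk₂] at h₃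
  have hV : 0 ≤ M + 1 / 4 * Finf * T := by
    have : 0 ≤ T := ht.trans htT
    positivity
  have hC : 0 ≤ M + 1 / 4 * Finf * T + 4 * Finf * h := by positivity
  have hr : h ≤ t - s + h := by linarith
  constructor
  · refine ((h₁.1.symm.trans h₂.1).trans h₃.1).mono hSs.energy.monotone ?_
    nlinarith
  · intro x
    have b₁ := h₁.2.abs_sub_le hSs x
    have b₂ := h₂.2.abs_sub_le hS x
    have b₃ := h₃.2.abs_sub_le hSt x
    have hFr : 9 / 4 * Finf * h ≤ 9 / 4 * Finf * (t - s + h) := by gcongr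
    have hFm : m * (9 / 4 * Finf * h) ≤ 9 / 4 * Finf * (t - s + h) := by nlinarith
    have q₁ : √(Finf * ((M + 1 / 4 * Finf * T) * h)) ≤
        √(Finf * ((M + 1 / 4 * Finf * T) * (t - s + h))) := by gcongr
    have q₂ : √(Finf * (m * ((M + 1 / 4 * Finf * T) * h))) ≤
        √(Finf * ((M + 1 / 4 * Finf * T) * (t - s + h))) := by
      apply Real.sqrt_le_sqrt
      gcongr Finf * ?_
      nlinarith
    rw [abs_sub_comm] at b₁
    have t₁ := abs_sub_le ((numSol dx Finf w t).1 x) ((scheme dx Finf w (n + m)).1 x)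
      ((numSol dx Finf w s).1 x)
    have t₂ := abs_sub_le ((scheme dx Finf w (n + m)).1 x) ((scheme dx Finf w n).1 x)
      ((numSol dx Finf w s).1 x)
    linarith

theorem numSol_zero (hdx : 0 < dx) : numSol dx Finf w 0 = proj dx w := by
  simp [numSol, scheme, evolve_zero, proj_proj hdx]

theorem gClose_initial (hdx : 0 < dx) (hF : 0 < Finf) (hw : IsState Finf M w) {t T : ℝ}
    (ht : 0 ≤ t) (htT : t ≤ T) :
    GClose (dx + 3 * ((M + 1 / 4 * Finf * T + 4 * Finf * timeStep dx Finf) *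
        (t + timeStep dx Finf))) w.2 (numSol dx Finf w t).2 := by
  have h := (numSol_close hdx hF hw le_rfl ht htT).1
  rw [sub_zero, numSol_zero hdx] at h
  exact (gClose_proj hdx hw.energy.monotone).trans h

/-- For a fixed mesh size the second component is Lipschitz in time, uniformly in space. -/
theorem abs_numSol_sub_le (hdx : 0 < dx) (hF : 0 < Finf) (hw : IsState Finf M w) {s t T : ℝ}
    (hs : 0 ≤ s) (hst : s ≤ t) (htT : t ≤ T) (x : ℝ) :
    |(numSol dx Finf w t).2 x - (numSol dx Finf w s).2 x| ≤
      Finf / (dx / 2) * (M + 1 / 4 * Finf * (T + timeStep dx Finf)) * (t - s) := by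
  have hp := timeStep_pos hdx hF
  have hM : 0 ≤ M := (abs_nonneg _).trans (hw.abs_fst_le 0)
  revert hs htT
  -- The time axis is cut into the steps of the scheme, viewed as a grid of mesh `Δt`; the estimate
  -- is additive over them.
  refine (isNodes_gridPt hp).rel_of_cells (r := fun s t => 0 ≤ s → t ≤ T →
    |(numSol dx Finf w t).2 x - (numSol dx Finf w s).2 x| ≤
      Finf / (dx / 2) * (M + 1 / 4 * Finf * (T + timeStep dx Finf)) * (t - s)) ?_ ?_ hst
  · intro a b c hab hbc h₁ h₂ ha hc
    have := abs_sub_le ((numSol dx Finf w c).2 x) ((numSol dx Finf w b).2 x)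
      ((numSol dx Finf w a).2 x)
    linarith [h₁ ha (hbc.trans hc), h₂ (ha.trans hab) hc]
  · intro j a b h₁ h₂ h₃ ha hb
    simp only [gridPt] at h₁ h₃
    rcases lt_or_ge j 0 with hj | hj
    · have hj' : ((j + 1 : ℤ) : ℝ) ≤ 0 := by exact_mod_cast hj
      have : b ≤ 0 := h₃.trans (mul_nonpos_of_nonpos_of_nonneg hj' hp.le)
      obtain rfl : b = a := by linarith
      simp
    lift j to ℕ using hj
    push_cast at h₁ h₃
    have hS := isState_scheme hdx hF hw j
    rw [numSol_of_mem hdx hF h₁ (h₂.trans h₃), numSol_of_mem hdx hF (h₁.trans h₂) h₃]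
    simp only [proj]
    refine abs_interp_sub_interp_le (isNodes_gridPt hdx) (fun i => ?_) x
    obtain ⟨y, hy₁, hy₂, -⟩ := hS.exists_evolve_eq hdx hF (sub_nonneg.2 h₁)
      (by linarith : a - j * timeStep dx Finf ≤ timeStep dx Finf) (sub_nonneg.2 (h₁.trans h₂))
      (by linarith) le_rfl (gridPt dx i)
    rw [← hy₂]
    -- The value at the grid point at time `a` is found at `y` at time `b`. The later profile is
    -- Lipschitz, as its breakpoints are at least `Δx / 2` apart.
    have hlip := abs_interp_sub_le (V := fun i => (scheme dx Finf w j).2 (gridPt dx i))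
      (hS.isNodes_breakPt hdx hF (sub_nonneg.2 (h₁.trans h₂)) (by linarith)) (half_pos hdx)
      (A := Finf) (hS.half_le_breakPt_sub hdx hF (sub_nonneg.2 (h₁.trans h₂)) (by linarith))
      (fun i => by
        have e₁ := hS.mem_Icc (gridPt dx i)
        have e₂ := hS.mem_Icc (gridPt dx (i + 1))
        rw [abs_le]; constructor <;> linarith [e₁.1, e₁.2, e₂.1, e₂.2]) (gridPt dx i) y
    refine hlip.trans ?_
    rw [mul_assoc]
    gcongr
    rw [abs_sub_comm]
    refine hy₁.trans ?_
    rw [show b - j * timeStep dx Finf - (a - j * timeStep dx Finf) = b - a by ring,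
      abs_of_nonneg (sub_nonneg.2 h₂)]
    have hba : 0 ≤ b - a := by linarith
    refine mul_le_mul_of_nonneg_right ?_ hba
    have : j * timeStep dx Finf ≤ T := by linarith
    have := mul_le_mul_of_nonneg_left this hF.le
    linarith

end TimeModulus


/-! ### From the weak derivative to the pointwise energy condition -/

/-- Smooth bumps at the origin that shrink to a point. -/
noncomputable def bumpSeq (n : ℕ) : ContDiffBump (0 : ℝ) where
  rIn := 1 / (2 * (n + 1))
  rOut := 1 / (n + 1)
  rIn_pos := by positivity
  rIn_lt_rOut := by
    apply one_div_lt_one_div_of_lt <;> have : (0 : ℝ) ≤ n := by positivity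
    all_goals linarith

theorem tendsto_bumpSeq_rOut : Tendsto (fun n => (bumpSeq n).rOut) atTop (𝓝 0) :=
  tendsto_one_div_add_atTop_nhds_zero_nat

/-- The mollified indicator function of `[a, b]`. -/
noncomputable def smoothIndicator (a b : ℝ) (n : ℕ) (x : ℝ) : ℝ :=
  ∫ y in (x - b)..(x - a), (bumpSeq n).normed volume y

theorem hasDerivAt_smoothIndicator (a b : ℝ) (n : ℕ) (x : ℝ) :
    HasDerivAt (smoothIndicator a b n)
      ((bumpSeq n).normed volume (x - a) - (bumpSeq n).normed volume (x - b)) x := by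
  have hc : Continuous ((bumpSeq n).normed volume) := (bumpSeq n).continuous_normed
  have h : smoothIndicator a b n = fun x => (∫ y in (0)..(x - a), (bumpSeq n).normed volume y) -
      ∫ y in (0)..(x - b), (bumpSeq n).normed volume y := by
    funext x
    rw [smoothIndicator, intervalIntegral.integral_interval_sub_left] <;>
      exact hc.intervalIntegrable _ _
  rw [h]
  have key : ∀ c, HasDerivAt (fun x => ∫ y in (0)..(x - c), (bumpSeq n).normed volume y)
      ((bumpSeq n).normed volume (x - c)) x := fun c => by
    have h₁ : HasDerivAt (fun z => ∫ y in (0)..z, (bumpSeq n).normed volume y)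
        ((bumpSeq n).normed volume (x - c)) (x - c) :=
      (hc.integral_hasStrictDerivAt 0 (x - c)).hasDerivAt
    exact h₁.comp_sub_const x c
  exact (key a).sub (key b)

theorem contDiff_smoothIndicator (a b : ℝ) (n : ℕ) : ContDiff ℝ ∞ (smoothIndicator a b n) := by
  rw [contDiff_infty_iff_deriv]
  refine ⟨fun x => (hasDerivAt_smoothIndicator a b n x).differentiableAt, ?_⟩
  have : deriv (smoothIndicator a b n) = fun x =>
      (bumpSeq n).normed volume (x - a) - (bumpSeq n).normed volume (x - b) :=
    funext fun x => (hasDerivAt_smoothIndicator a b n x).deriv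
  rw [this]
  have hb : ContDiff ℝ ∞ ((bumpSeq n).normed volume) := (bumpSeq n).contDiff_normed
  exact (hb.comp (contDiff_id.sub contDiff_const)).sub (hb.comp (contDiff_id.sub contDiff_const))

theorem bumpSeq_normed_eq_zero {n : ℕ} {y : ℝ} (h : (bumpSeq n).rOut ≤ |y|) :
    (bumpSeq n).normed volume y = 0 := by
  by_contra hy
  have : y ∈ Function.support ((bumpSeq n).normed volume) := hy
  rw [ContDiffBump.support_normed_eq, mem_ball_zero_iff, Real.norm_eq_abs] at this
  linarith

theorem smoothIndicator_mem_Icc {a b : ℝ} (hab : a ≤ b) (n : ℕ) (x : ℝ) :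
    smoothIndicator a b n x ∈ Icc 0 1 := by
  have hi := (bumpSeq n).integrable_normed (μ := volume)
  rw [smoothIndicator, intervalIntegral.integral_of_le (by linarith)]
  refine ⟨integral_nonneg fun y => (bumpSeq n).nonneg_normed y, ?_⟩
  refine (setIntegral_le_integral hi (Eventually.of_forall fun y =>
    (bumpSeq n).nonneg_normed y)).trans_eq ?_
  exact (bumpSeq n).integral_normed

theorem smoothIndicator_eq_zero {a b : ℝ} {n : ℕ} {x : ℝ}
    (h : x + (bumpSeq n).rOut ≤ a ∨ b + (bumpSeq n).rOut ≤ x) (hab : a ≤ b) :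
    smoothIndicator a b n x = 0 := by
  rw [smoothIndicator, intervalIntegral.integral_of_le (by linarith)]
  refine setIntegral_eq_zero_of_forall_eq_zero fun y hy => bumpSeq_normed_eq_zero ?_
  rcases h with h | h
  · exact le_trans (by linarith [hy.2]) (neg_le_abs y)
  · exact le_trans (by linarith [hy.1]) (le_abs_self y)

theorem smoothIndicator_eq_one {a b : ℝ} {n : ℕ} {x : ℝ} (h₁ : a + (bumpSeq n).rOut ≤ x)
    (h₂ : x + (bumpSeq n).rOut < b) : smoothIndicator a b n x = 1 := by
  have hp := (bumpSeq n).rOut_pos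
  rw [smoothIndicator, intervalIntegral.integral_eq_integral_of_support_subset]
  · exact (bumpSeq n).integral_normed
  · rw [ContDiffBump.support_normed_eq]
    intro y hy
    rw [mem_ball_zero_iff, Real.norm_eq_abs, abs_lt] at hy
    constructor <;> linarith [hy.1, hy.2]

theorem tendsto_integral_mul_bumpSeq {u : ℝ → ℝ} (hu : Continuous u) (a : ℝ) :
    Tendsto (fun n => ∫ x, u x * (bumpSeq n).normed volume (x - a)) atTop (𝓝 (u a)) := by
  have h := ContDiffBump.convolution_tendsto_right_of_continuous (μ := (volume : Measure ℝ))
    tendsto_bumpSeq_rOut hu a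
  refine h.congr fun n => ?_
  rw [convolution_def, ← integral_sub_left_eq_self _ volume a]
  refine integral_congr_ae (Eventually.of_forall fun x => ?_)
  simp only [sub_sub_cancel, ContinuousLinearMap.lsmul_apply, smul_eq_mul]
  rw [← (bumpSeq n).normed_neg (x - a), neg_sub, mul_comm]

/-- A continuous function with a weak derivative is its primitive. -/
theorem HasWeakDeriv.sub_eq_integral {u v : ℝ → ℝ} (h : HasWeakDeriv u v) (hu : Continuous u)
    {a b : ℝ} (hab : a ≤ b) : u b - u a = ∫ x in a..b, v x := by
  obtain ⟨-, hv, htest⟩ := h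
  have hrOut : ∀ n, (bumpSeq n).rOut ≤ 1 := fun n => by
    show (1 : ℝ) / (n + 1) ≤ 1
    rw [div_le_one (by positivity)]
    linarith [(Nat.cast_nonneg n : (0 : ℝ) ≤ n)]
  have hzero : ∀ n x, x ∉ Icc (a - 1) (b + 1) → smoothIndicator a b n x = 0 := fun n x hx => by
    apply smoothIndicator_eq_zero _ hab
    by_contra hcon
    rw [not_or, not_le, not_le] at hcon
    exact hx ⟨by linarith [hrOut n, hcon.1], by linarith [hrOut n, hcon.2]⟩
  have hcomp : ∀ n, HasCompactSupport (smoothIndicator a b n) := fun n =>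
    HasCompactSupport.intro isCompact_Icc (hzero n)
  -- The mollified indicator is the test function: its derivative is a bump at `a` minus a bump at
  -- `b`.
  have h₁ : ∀ n, (∫ x, u x * (bumpSeq n).normed volume (x - a)) -
      (∫ x, u x * (bumpSeq n).normed volume (x - b)) = - ∫ x, v x * smoothIndicator a b n x := by
    intro n
    rw [← htest _ (contDiff_smoothIndicator a b n) (hcomp n), ← integral_sub]
    · refine integral_congr_ae (Eventually.of_forall fun x => ?_)
      simp only [(hasDerivAt_smoothIndicator a b n x).deriv, mul_sub]
    all_goals
      refine (hu.mul ((bumpSeq n).continuous_normed.comp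
        (continuous_id.sub continuous_const))).integrable_of_hasCompactSupport ?_
      refine HasCompactSupport.mul_left ?_
      exact ((bumpSeq n).hasCompactSupport_normed).comp_homeomorph (Homeomorph.subRight _)
  have h₂ : Tendsto (fun n => ∫ x, v x * smoothIndicator a b n x) atTop
      (𝓝 (∫ x, (Ioc a b).indicator v x)) := by
    refine tendsto_integral_of_dominated_convergence
      (fun x => (Icc (a - 1) (b + 1)).indicator (fun x => |v x|) x) (fun n => ?_) ?_ (fun n => ?_) ?_
    · exact hv.aestronglyMeasurable.mul
        (contDiff_smoothIndicator a b n).continuous.aestronglyMeasurable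
    · exact (integrable_indicator_iff measurableSet_Icc).2
        (hv.integrableOn_isCompact isCompact_Icc).abs
    · refine Eventually.of_forall fun x => ?_
      by_cases hx : x ∈ Icc (a - 1) (b + 1)
      · rw [indicator_of_mem hx, norm_mul, Real.norm_eq_abs, Real.norm_eq_abs]
        have := smoothIndicator_mem_Icc hab n x
        rw [abs_of_nonneg this.1]
        exact mul_le_of_le_one_right (abs_nonneg _) this.2
      · rw [hzero n x hx, indicator_of_notMem hx]; simp
    -- The endpoints are discarded, since the mollified indicators need not converge to the
    -- indicator there.
    · have hne : ∀ c : ℝ, ∀ᵐ x, x ≠ c := fun c => by simp [ae_iff]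
      filter_upwards [hne a, hne b] with x ha hb
      refine tendsto_const_nhds.congr' ?_
      by_cases hx : x ∈ Ioc a b
      · have hpos : 0 < min (x - a) (b - x) :=
          lt_min (by linarith [hx.1]) (by linarith [lt_of_le_of_ne hx.2 hb])
        filter_upwards [tendsto_bumpSeq_rOut.eventually (gt_mem_nhds hpos)] with n hn
        rw [lt_min_iff] at hn
        rw [indicator_of_mem hx, smoothIndicator_eq_one (by linarith) (by linarith), mul_one]
      · have hpos : 0 < max (a - x) (x - b) := by
          rw [lt_max_iff]
          by_contra hcon
          rw [not_or, not_lt, not_lt] at hcon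
          exact hx ⟨lt_of_le_of_ne (by linarith) (Ne.symm ha), by linarith⟩
        filter_upwards [tendsto_bumpSeq_rOut.eventually (gt_mem_nhds hpos)] with n hn
        rw [lt_max_iff] at hn
        rw [indicator_of_notMem hx, smoothIndicator_eq_zero _ hab, mul_zero]
        exact hn.imp (by intro h; linarith) (by intro h; linarith)
  have h₃ := tendsto_nhds_unique (((tendsto_integral_mul_bumpSeq hu a).sub
    (tendsto_integral_mul_bumpSeq hu b)).congr h₁) h₂.neg
  rw [integral_indicator measurableSet_Ioc, ← intervalIntegral.integral_of_le hab] at h₃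
  linarith

/-- Cauchy–Schwarz against the constant `1`, obtained by expanding `∫ ((b - a) v - I)² ≥ 0`. -/
theorem sq_intervalIntegral_le {v : ℝ → ℝ} (hv : MemLp v 2 volume) {a b : ℝ} (hab : a < b) :
    (∫ x in a..b, v x) ^ 2 ≤ (b - a) * ∫ x in a..b, v x ^ 2 := by
  have hi : IntervalIntegrable v volume a b :=
    ((hv.locallyIntegrable (by norm_num)).integrableOn_isCompact isCompact_uIcc).intervalIntegrable
  have hi₂ : IntervalIntegrable (fun x => v x ^ 2) volume a b := hv.integrable_sq.intervalIntegrable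
  set I := ∫ x in a..b, v x
  set J := ∫ x in a..b, v x ^ 2
  have hba : 0 < b - a := sub_pos.2 hab
  have h : 0 ≤ ∫ x in a..b, ((b - a) * v x - I) ^ 2 :=
    intervalIntegral.integral_nonneg hab.le fun x _ => sq_nonneg _
  have e : ∫ x in a..b, ((b - a) * v x - I) ^ 2 = (b - a) ^ 2 * J - 2 * (b - a) * I * I +
      (b - a) * I ^ 2 := by
    have : ∀ x, ((b - a) * v x - I) ^ 2 =
        (b - a) ^ 2 * v x ^ 2 - 2 * (b - a) * I * v x + I ^ 2 := fun x => by ring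
    simp_rw [this]
    rw [intervalIntegral.integral_add, intervalIntegral.integral_sub,
      intervalIntegral.integral_const_mul, intervalIntegral.integral_const_mul,
      intervalIntegral.integral_const, smul_eq_mul]
    · exact hi₂.const_mul _
    · exact hi.const_mul _
    · exact (hi₂.const_mul _).sub (hi.const_mul _)
    · exact intervalIntegrable_const
  rw [e] at h
  have : 0 ≤ (b - a) * ((b - a) * J - I ^ 2) := by linarith
  linarith [nonneg_of_mul_nonneg_right this hba]

/-- Cauchy–Schwarz for the primitive of `u_x`. Replacing the one-sided limits by `F b - F a` loses
nothing in the end: `integral_deriv_le_of_monotone` recovers them. -/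
theorem MemD.energyPair {Finf : ℝ} {u F : ℝ → ℝ} (h : MemD Finf u F) : EnergyPair u F := by
  intro a b hab
  refine ⟨h.F_mono hab, ?_⟩
  rcases hab.eq_or_lt with rfl | hab'
  · simp
  obtain ⟨ux, hux, hL2, hen⟩ := h.energy
  rw [hux.sub_eq_integral h.continuous_u hab]
  refine (sq_intervalIntegral_le hL2 hab').trans ?_
  have : Function.leftLim F b - Function.rightLim F a ≤ F b - F a :=
    sub_le_sub (h.F_mono.leftLim_le le_rfl) (h.F_mono.le_rightLim le_rfl)
  exact mul_le_mul_of_nonneg_left ((hen a b hab').trans this) (sub_nonneg.2 hab)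


/-! ### From the pointwise energy condition back to `𝒟` -/

/-- The increments of a monotone function over disjoint intervals add up to at most its total
increment. -/
theorem sum_dist_le_of_monotone {F : ℝ → ℝ} (hF : Monotone F) {a b : ℝ} (hab : a ≤ b) {n : ℕ}
    {I : ℕ → ℝ × ℝ} (h : (n, I) ∈ AbsolutelyContinuousOnInterval.disjWithin a b) :
    ∑ i ∈ Finset.range n, dist (F (I i).1) (F (I i).2) ≤ F b - F a := by
  obtain ⟨hmem, hdisj⟩ := h
  have hmin : ∀ x y, F (min x y) = min (F x) (F y) := fun x y => hF.map_min
  have hmax : ∀ x y, F (max x y) = max (F x) (F y) := fun x y => hF.map_max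
  -- A monotone map sends disjoint half-open intervals to value intervals that are again disjoint,
  -- so the increments are compared through Lebesgue measure.
  have hd : Set.PairwiseDisjoint (Finset.range n : Set ℕ)
      (fun i => uIoc (F (I i).1) (F (I i).2)) := by
    intro i hi j hj hij
    have h₁ := hdisj hi hj hij
    simp only [Function.onFun, uIoc, Set.Ioc_disjoint_Ioc] at h₁ ⊢
    simp only [← hmin, ← hmax]
    exact hF h₁
  have hsub : (⋃ i ∈ Finset.range n, uIoc (F (I i).1) (F (I i).2)) ⊆ Ioc (F a) (F b) := by
    refine iUnion₂_subset fun i hi => ?_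
    have := hmem i hi
    rw [uIcc_of_le hab] at this
    refine Ioc_subset_Ioc ?_ ?_
    · exact le_min (hF this.1.1) (hF this.2.1)
    · exact max_le (hF this.1.2) (hF this.2.2)
  have hvol := measure_mono (μ := volume) hsub
  rw [measure_biUnion_finset hd (fun i _ => measurableSet_uIoc), Real.volume_Ioc] at hvol
  simp only [uIoc, Real.volume_Ioc, max_sub_min_eq_abs'] at hvol
  rw [← ENNReal.ofReal_sum_of_nonneg (fun _ _ => abs_nonneg _),
    ENNReal.ofReal_le_ofReal_iff (sub_nonneg.2 (hF hab))] at hvol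
  simpa [Real.dist_eq] using hvol

theorem EnergyPair.dist_le {u F : ℝ → ℝ} (h : EnergyPair u F) (x y : ℝ) :
    dist (u x) (u y) ≤ √(dist x y) * √(dist (F x) (F y)) := by
  wlog hyx : y ≤ x generalizing x y
  · rw [dist_comm, dist_comm x, dist_comm (F x)]; exact this y x (le_of_not_ge hyx)
  obtain ⟨h₁, h₂⟩ := h y x hyx
  rw [← Real.sqrt_mul dist_nonneg, Real.dist_eq, Real.dist_eq, Real.dist_eq,
    abs_of_nonneg (sub_nonneg.2 hyx), abs_of_nonneg (sub_nonneg.2 h₁)]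
  exact Real.abs_le_sqrt h₂

/-- Cauchy–Schwarz over a finite disjoint family bounds the variation of `u` by the root of the
total length times the root of the increment of `F`. -/
theorem EnergyPair.absolutelyContinuousOnInterval {u F : ℝ → ℝ} (h : EnergyPair u F) {a b : ℝ}
    (hab : a ≤ b) : AbsolutelyContinuousOnInterval u a b := by
  rw [absolutelyContinuousOnInterval_iff]
  intro ε hε
  have hFab : 0 ≤ F b - F a := sub_nonneg.2 (h.monotone hab)
  refine ⟨ε ^ 2 / (F b - F a + 1), by positivity, ?_⟩
  rintro ⟨n, I⟩ hE hδ
  simp only at hδ ⊢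
  have h₁ := sum_dist_le_of_monotone h.monotone hab hE
  calc ∑ i ∈ Finset.range n, dist (u (I i).1) (u (I i).2)
      ≤ ∑ i ∈ Finset.range n, √(dist (I i).1 (I i).2) * √(dist (F (I i).1) (F (I i).2)) :=
        Finset.sum_le_sum fun i _ => h.dist_le _ _
    _ ≤ √(∑ i ∈ Finset.range n, dist (I i).1 (I i).2) *
        √(∑ i ∈ Finset.range n, dist (F (I i).1) (F (I i).2)) :=
        Real.sum_sqrt_mul_sqrt_le _ (fun _ => dist_nonneg) (fun _ => dist_nonneg)
    _ ≤ √(∑ i ∈ Finset.range n, dist (I i).1 (I i).2) * √(F b - F a + 1) := by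
        gcongr; linarith
    _ < √(ε ^ 2 / (F b - F a + 1)) * √(F b - F a + 1) := by
        gcongr
    _ = ε := by
        rw [← Real.sqrt_mul (by positivity), div_mul_cancel₀ _ (by positivity),
          Real.sqrt_sq hε.le]

theorem EnergyPair.ae_deriv_sq_le {u F : ℝ → ℝ} (h : EnergyPair u F) :
    ∀ᵐ x, deriv u x ^ 2 ≤ deriv F x := by
  filter_upwards [h.monotone.ae_differentiableAt] with x hF
  have hF0 : 0 ≤ deriv F x := h.monotone.deriv_nonneg
  by_cases hu : DifferentiableAt ℝ u x
  · have h₁ := (hasDerivAt_iff_tendsto_slope.1 hu.hasDerivAt).pow 2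
    have h₂ := hasDerivAt_iff_tendsto_slope.1 hF.hasDerivAt
    refine le_of_tendsto_of_tendsto h₁ h₂ ?_
    filter_upwards [self_mem_nhdsWithin] with y hy
    have hne : y - x ≠ 0 := sub_ne_zero.2 hy
    rw [slope_def_field, slope_def_field, div_pow, div_le_iff₀ (by positivity)]
    have e : (F y - F x) / (y - x) * (y - x) ^ 2 = (y - x) * (F y - F x) := by
      field_simp
    rw [e]
    rcases le_total x y with hxy | hxy
    · exact (h x y hxy).2
    · have := (h y x hxy).2
      nlinarith
  -- At points where `u` is not differentiable `deriv` takes its default value `0`, so `F' ≥ 0`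
  -- suffices.
  · rw [deriv_zero_of_not_differentiableAt hu]; simpa using hF0

/-- Lebesgue's inequality for monotone functions, applied after resetting the two endpoint values to
the inner one-sided limits. This leaves the derivative on the open interval unchanged. -/
theorem integral_deriv_le_of_monotone {F : ℝ → ℝ} (hF : Monotone F) {a b : ℝ} (hab : a < b) :
    IntervalIntegrable (deriv F) volume a b ∧
      ∫ x in a..b, deriv F x ≤ Function.leftLim F b - Function.rightLim F a := by
  refine ⟨(hF.monotoneOn _).intervalIntegrable_deriv, ?_⟩
  set G := Function.update (Function.update F a (Function.rightLim F a)) b (Function.leftLim F b)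
    with hG
  have hGa : G a = Function.rightLim F a := by simp [hG, hab.ne]
  have hGb : G b = Function.leftLim F b := by simp [hG]
  have hGx : ∀ x, x ≠ a → x ≠ b → G x = F x := fun x h₁ h₂ => by simp [hG, h₁, h₂]
  have hmono : MonotoneOn G (uIcc a b) := by
    rw [uIcc_of_le hab.le]
    intro x hx y hy hxy
    have l₁ : ∀ z, a < z → Function.rightLim F a ≤ F z := fun z hz => hF.rightLim_le hz
    have l₂ : ∀ z, z < b → F z ≤ Function.leftLim F b := fun z hz => hF.le_leftLim hz
    have l₃ := hF.rightLim_le_leftLim hab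
    rcases eq_or_ne x a with rfl | hxa
    · rcases eq_or_ne y b with rfl | hyb
      · rw [hGa, hGb]; exact l₃
      · rcases eq_or_ne y x with rfl | hyx
        · rfl
        rw [hGa, hGx y hyx hyb]
        exact l₁ y (lt_of_le_of_ne hxy hyx.symm)
    · have hya : y ≠ a := by rintro rfl; exact hxa (le_antisymm hxy hx.1)
      rcases eq_or_ne y b with rfl | hyb
      · rcases eq_or_ne x y with rfl | hxb
        · rfl
        rw [hGx x hxa hxb, hGb]
        exact l₂ x (lt_of_le_of_ne hxy hxb)
      · have hxb : x ≠ b := by rintro rfl; exact hyb (le_antisymm hy.2 hxy)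
        rw [hGx x hxa hxb, hGx y hya hyb]
        exact hF hxy
  have h := hmono.intervalIntegral_deriv_mem_uIcc
  rw [hGa, hGb, uIcc_of_le (sub_nonneg.2 (hF.rightLim_le_leftLim hab))] at h
  refine le_trans (le_of_eq ?_) h.2
  rw [intervalIntegral.integral_of_le hab.le, intervalIntegral.integral_of_le hab.le,
    integral_Ioc_eq_integral_Ioo, integral_Ioc_eq_integral_Ioo]
  refine setIntegral_congr_fun measurableSet_Ioo fun x hx => ?_
  refine (EventuallyEq.deriv_eq ?_).symm
  filter_upwards [Ioo_mem_nhds hx.1 hx.2] with y hy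
  exact hGx y hy.1.ne' hy.2.ne

theorem EnergyPair.integral_deriv_sq_le {u F : ℝ → ℝ} (h : EnergyPair u F) {a b : ℝ}
    (hab : a < b) : IntervalIntegrable (fun x => deriv u x ^ 2) volume a b ∧
      ∫ x in a..b, deriv u x ^ 2 ≤ Function.leftLim F b - Function.rightLim F a := by
  obtain ⟨h₁, h₂⟩ := integral_deriv_le_of_monotone h.monotone hab
  have hi : IntervalIntegrable (fun x => deriv u x ^ 2) volume a b := by
    refine h₁.mono_fun ((measurable_deriv u).pow_const 2).aestronglyMeasurable ?_
    refine ae_restrict_of_ae ?_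
    filter_upwards [h.ae_deriv_sq_le] with x hx
    rw [Real.norm_of_nonneg (sq_nonneg _)]
    exact hx.trans (le_abs_self _)
  refine ⟨hi, le_trans ?_ h₂⟩
  exact intervalIntegral.integral_mono_ae hab.le hi h₁ h.ae_deriv_sq_le

theorem toReal_eLpNorm_top_eq {F : ℝ → ℝ} {c R : ℝ} (hF : ∀ x, F x ∈ Icc 0 c)
    (hR : ∀ x, R ≤ x → F x = c) : (eLpNorm F ∞ volume).toReal = c := by
  have hc : 0 ≤ c := (hF 0).1.trans (hF 0).2
  have : eLpNorm F ∞ volume = ENNReal.ofReal c := by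
    rw [eLpNorm_exponent_top]
    apply le_antisymm
    · refine eLpNormEssSup_le_of_ae_bound (Eventually.of_forall fun x => ?_)
      rw [Real.norm_of_nonneg (hF x).1]
      exact (hF x).2
    · by_contra! hlt
      have h₁ : ∀ᵐ x, ‖F x‖ₑ ≤ eLpNormEssSup F volume := ae_le_eLpNormEssSup
      have h₂ : Ici R ⊆ {x | ¬ ‖F x‖ₑ ≤ eLpNormEssSup F volume} := fun x hx => by
        rw [mem_ofPred_eq, not_le, hR x hx, Real.enorm_of_nonneg hc]
        exact hlt
      have h₃ := measure_mono_null h₂ h₁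
      simp at h₃
  rw [this, ENNReal.toReal_ofReal hc]

/-- The classical derivative is the weak one: absolute continuity allows integration by parts on an
interval containing the support of the test function. It is in `L²` because its energy on every
bounded interval is at most `Finf`. -/
theorem memD_of_energyPair {Finf M R : ℝ} {u F : ℝ → ℝ} (h : EnergyPair u F)
    (hF : ∀ x, F x ∈ Icc 0 Finf) (hu : ∀ x, |u x| ≤ M)
    (hleft : ∀ x, ContinuousWithinAt F (Iic x) x) (hbot : ∀ x, x ≤ -R → F x = 0)
    (htop : ∀ x, R ≤ x → F x = Finf) : MemD Finf u F := by
  have hS : IsState Finf M (u, F) := ⟨h, hF, hu⟩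
  have hcont : Continuous u := by
    rw [Metric.continuous_iff]
    intro x ε hε
    have hF0 : 0 ≤ Finf := (hF 0).1.trans (hF 0).2
    refine ⟨ε ^ 2 / (Finf + 1), by positivity, fun y hy => ?_⟩
    rw [Real.dist_eq] at hy
    refine lt_of_le_of_lt (hS.abs_sub_le le_rfl) ?_
    rw [Real.sqrt_lt' hε]
    rw [lt_div_iff₀ (by positivity)] at hy
    nlinarith [abs_nonneg (y - x)]
  have hint : Integrable (fun x => deriv u x ^ 2) volume := by
    refine integrable_of_intervalIntegral_norm_bounded (ι := ℕ) (l := atTop) Finf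
      (a := fun n => -((n : ℝ) + 1)) (b := fun n => (n : ℝ) + 1) (fun n => ?_) ?_ ?_ ?_
    · have h0 : -((n : ℝ) + 1) < n + 1 := by linarith [(Nat.cast_nonneg n : (0 : ℝ) ≤ n)]
      exact (h.integral_deriv_sq_le h0).1.1
    · exact tendsto_neg_atTop_atBot.comp
        (tendsto_atTop_add_const_right _ _ tendsto_natCast_atTop_atTop)
    · exact tendsto_atTop_add_const_right _ _ tendsto_natCast_atTop_atTop
    · refine Eventually.of_forall fun n => ?_
      have h0 : -((n : ℝ) + 1) < n + 1 := by linarith [(Nat.cast_nonneg n : (0 : ℝ) ≤ n)]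
      simp only [norm_pow, Real.norm_eq_abs, sq_abs]
      refine (h.integral_deriv_sq_le h0).2.trans ?_
      have a₁ := h.monotone.leftLim_le (le_refl ((n : ℝ) + 1))
      have a₂ := h.monotone.le_rightLim (le_refl (-((n : ℝ) + 1)))
      linarith [(hF (n + 1)).2, (hF (-((n : ℝ) + 1))).1]
  have hL2 : MemLp (deriv u) 2 volume :=
    (memLp_two_iff_integrable_sq (measurable_deriv u).aestronglyMeasurable).2 hint
  refine ⟨hcont, ?_, ?_, h.monotone, hleft, ?_, toReal_eLpNorm_top_eq hF htop, deriv u, ⟨?_, ?_, ?_⟩,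
    hL2, fun a b hab => (h.integral_deriv_sq_le hab).2⟩
  · exact memLp_top_of_bound hcont.aestronglyMeasurable M (Eventually.of_forall hu)
  · refine memLp_top_of_bound h.monotone.measurable.aestronglyMeasurable Finf
      (Eventually.of_forall fun x => ?_)
    rw [Real.norm_of_nonneg (hF x).1]
    exact (hF x).2
  · refine tendsto_const_nhds.congr' ?_
    filter_upwards [eventually_le_atBot (-R)] with x hx
    exact (hbot x hx).symm
  · exact hcont.locallyIntegrable
  · exact hL2.locallyIntegrable (by norm_num)
  · intro φ hφ hc
    obtain ⟨r, hr0, hr⟩ : ∃ r : ℝ, 0 < r ∧ tsupport φ ⊆ Ioo (-r) r := by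
      obtain ⟨r, hr⟩ := hc.isCompact.isBounded.subset_ball 0
      refine ⟨max r 1, by positivity, hr.trans fun x hx => ?_⟩
      rw [mem_ball_zero_iff, Real.norm_eq_abs, abs_lt] at hx
      have := le_max_left r 1
      constructor <;> linarith [hx.1, hx.2]
    have hrr : -r ≤ r := by linarith
    have hφr : ∀ x, x ∉ Ioo (-r) r → φ x = 0 := fun x hx =>
      image_eq_zero_of_notMem_tsupport fun hx' => hx (hr hx')
    have hac : AbsolutelyContinuousOnInterval φ (-r) r :=
      (hφ.of_le (by exact_mod_cast le_top)).contDiffOn.absolutelyContinuousOnInterval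
    have key := (h.absolutelyContinuousOnInterval hrr).integral_mul_deriv_eq_deriv_mul hac
    rw [hφr r (by simp), hφr (-r) (by simp)] at key
    rw [intervalIntegral.integral_eq_integral_of_support_subset,
      intervalIntegral.integral_eq_integral_of_support_subset] at key
    · simpa using key
    · intro x hx
      by_contra hx'
      exact hx (by simp [hφr x fun h => hx' (Ioo_subset_Ioc_self h)])
    · intro x hx
      have h₁ : x ∈ tsupport φ := by
        have : x ∈ Function.support (deriv φ) := right_ne_zero_of_mul hx
        exact support_deriv_subset this
      exact Ioo_subset_Ioc_self (hr h₁)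


/-! ### Compactness: convergence at rational points and limit of `u` -/

theorem exists_tendsto_of_approx {f : ℕ → ℝ}
    (h : ∀ η > 0, ∃ g : ℕ → ℝ, (∃ l, Tendsto g atTop (𝓝 l)) ∧ ∀ᶠ k in atTop, |f k - g k| ≤ η) :
    ∃ l, Tendsto f atTop (𝓝 l) := by
  refine cauchySeq_tendsto_of_complete (Metric.cauchySeq_iff.2 fun ε hε => ?_)
  obtain ⟨g, ⟨l, hl⟩, hg⟩ := h (ε / 4) (by positivity)
  obtain ⟨N, hN⟩ := eventually_atTop.1 (hg.and
    (Metric.tendsto_nhds.1 hl (ε / 4) (by positivity)))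
  refine ⟨N, fun m hm n hn => ?_⟩
  have h₁ := hN m hm
  have h₂ := hN n hn
  simp only [Real.dist_eq, abs_le, abs_lt] at h₁ h₂ ⊢
  constructor <;> linarith [h₁.1.1, h₁.1.2, h₁.2.1, h₁.2.2, h₂.1.1, h₂.1.2, h₂.2.1, h₂.2.2]

/-- Pointwise convergence to zero on a compact set is uniform for an asymptotically equicontinuous
sequence. -/
theorem eventually_le_of_equicontinuous {α : Type*} [PseudoMetricSpace α] {K : Set α}
    (hK : IsCompact K) {h : ℕ → α → ℝ} (hlim : ∀ p ∈ K, Tendsto (fun k => h k p) atTop (𝓝 0))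
    (heq : ∀ η > 0, ∃ δ > 0, ∀ᶠ k in atTop, ∀ p ∈ K, ∀ q ∈ K, dist p q < δ → h k p ≤ h k q + η)
    {η : ℝ} (hη : 0 < η) : ∀ᶠ k in atTop, ∀ p ∈ K, h k p ≤ η := by
  obtain ⟨δ, hδ, hev⟩ := heq (η / 2) (half_pos hη)
  obtain ⟨t, htK, htf, hcov⟩ := hK.finite_cover_balls hδ
  have hfin : ∀ᶠ k in atTop, ∀ q ∈ t, h k q ≤ η / 2 := by
    rw [eventually_all_finite htf]
    intro q hq
    filter_upwards [(hlim q (htK hq)).eventually (gt_mem_nhds (half_pos hη))] with k hk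
    exact hk.le
  filter_upwards [hev, hfin] with k h₁ h₂ p hp
  obtain ⟨q, hq, hpq⟩ := mem_iUnion₂.1 (hcov hp)
  linarith [h₁ p hp q (htK hq) hpq, h₂ q hq]

/-- Sequences of pairs with the energy condition that are asymptotically equicontinuous in time
and have uniformly compactly supported energy. -/
structure IsApprox (Finf M : ℝ) (u F : ℕ → ℝ → ℝ → ℝ) : Prop where
  state : ∀ k t, 0 ≤ t → IsState Finf (M + 1 / 4 * Finf * t) (u k t, F k t)
  modulus : ∀ T, 0 < T → ∃ C, 0 ≤ C ∧ ∃ ε : ℕ → ℝ, Tendsto ε atTop (𝓝 0) ∧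
    ∀ k s t, 0 ≤ s → s ≤ t → t ≤ T → GClose (C * (t - s) + ε k) (F k s) (F k t) ∧
      ∀ x, |u k t x - u k s x| ≤ C * √(t - s) + ε k
  support : ∀ T, 0 < T → ∃ R, 0 ≤ R ∧ ∀ k t, 0 ≤ t → t ≤ T →
    (∀ x, x ≤ -R → F k t x = 0) ∧ ∀ x, R ≤ x → F k t x = Finf

/-- Convergence at rational points along a subsequence. -/
theorem IsApprox.exists_subseq {Finf M : ℝ} {u F : ℕ → ℝ → ℝ → ℝ} (h : IsApprox Finf M u F) :
    ∃ σ : ℕ → ℕ, StrictMono σ ∧ ∀ q r : ℚ, 0 ≤ q →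
      (∃ l, Tendsto (fun k => u (σ k) q r) atTop (𝓝 l)) ∧
      ∃ l, Tendsto (fun k => F (σ k) q r) atTop (𝓝 l) := by
  -- Tychonoff in a countable product replaces the diagonal argument. Negative times, where no bound
  -- is available, get the value `0`.
  let Φ : ℕ → (ℚ × ℚ → ℝ × ℝ) := fun k p => if 0 ≤ p.1 then (u k p.1 p.2, F k p.1 p.2) else 0
  let K : Set (ℚ × ℚ → ℝ × ℝ) := Set.pi univ fun p =>
    Metric.closedBall 0 (|M| + |1 / 4 * Finf * p.1| + |Finf|)
  have hK : IsCompact K := isCompact_univ_pi fun p => isCompact_closedBall _ _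
  have hΦ : ∀ k, Φ k ∈ K := by
    intro k p _
    simp only [mem_closedBall_zero_iff, Φ]
    split_ifs with hp
    · have hp' : (0 : ℝ) ≤ p.1 := by exact_mod_cast hp
      have hs := h.state k p.1 hp'
      have h₁ : |u k p.1 p.2| ≤ _ := hs.abs_fst_le p.2
      have h₂ : F k p.1 p.2 ∈ _ := hs.mem_Icc p.2
      rw [Prod.norm_mk, max_le_iff, Real.norm_eq_abs, Real.norm_eq_abs, abs_of_nonneg h₂.1]
      have a₁ := le_abs_self M
      have a₂ := le_abs_self (1 / 4 * Finf * p.1)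
      have a₃ := le_abs_self Finf
      constructor
      · linarith [abs_nonneg Finf]
      · linarith [h₂.2, abs_nonneg M, abs_nonneg (1 / 4 * Finf * p.1)]
    · simp only [norm_zero]; positivity
  obtain ⟨l, -, σ, hσ, hl⟩ := hK.tendsto_subseq hΦ
  refine ⟨σ, hσ, fun q r hq => ?_⟩
  have := tendsto_pi_nhds.1 hl (q, r)
  simp only [Function.comp_def, Φ, hq, if_true] at this
  exact ⟨⟨_, (continuous_fst.tendsto _).comp this⟩, ⟨_, (continuous_snd.tendsto _).comp this⟩⟩

/-- Joint modulus of continuity of the first components. -/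
theorem IsApprox.exists_abs_sub_le {Finf M : ℝ} {u F : ℕ → ℝ → ℝ → ℝ} (h : IsApprox Finf M u F)
    {T : ℝ} (hT : 0 < T) : ∃ C, 0 ≤ C ∧ ∃ ε : ℕ → ℝ, Tendsto ε atTop (𝓝 0) ∧
      ∀ k, ∀ p ∈ Icc 0 T ×ˢ (univ : Set ℝ), ∀ q ∈ Icc 0 T ×ˢ (univ : Set ℝ),
        |u k p.1 p.2 - u k q.1 q.2| ≤ C * √(dist p q) + ε k := by
  obtain ⟨C, hC, ε, hε, H⟩ := h.modulus T hT
  refine ⟨C + √Finf, by positivity, ε, hε, ?_⟩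
  rintro k ⟨t, x⟩ ⟨ht, -⟩ ⟨s, y⟩ ⟨hs, -⟩
  simp only at ht hs ⊢
  have h₁ : dist t s ≤ dist (t, x) (s, y) := le_max_left _ _
  have h₂ : dist x y ≤ dist (t, x) (s, y) := le_max_right _ _
  have b₁ : |u k t x - u k s x| ≤ C * √(dist t s) + ε k := by
    rcases le_total s t with hst | hst
    · rw [Real.dist_eq, abs_of_nonneg (sub_nonneg.2 hst)]
      exact (H k s t hs.1 hst ht.2).2 x
    · rw [abs_sub_comm, dist_comm, Real.dist_eq, abs_of_nonneg (sub_nonneg.2 hst)]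
      exact (H k t s ht.1 hst hs.2).2 x
  have b₂ : |u k s x - u k s y| ≤ √Finf * √(dist x y) := by
    have hF : 0 ≤ Finf := ((h.state k s hs.1).mem_Icc 0).1.trans ((h.state k s hs.1).mem_Icc 0).2
    rw [← Real.sqrt_mul hF]
    exact (h.state k s hs.1).abs_sub_le le_rfl
  have b₃ : C * √(dist t s) ≤ C * √(dist (t, x) (s, y)) := by gcongr
  have b₄ : √Finf * √(dist x y) ≤ √Finf * √(dist (t, x) (s, y)) := by gcongr
  linarith [abs_sub_le (u k t x) (u k s x) (u k s y)]

theorem exists_sqrt_lt {C η : ℝ} (hC : 0 ≤ C) (hη : 0 < η) :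
    ∃ δ > 0, ∀ d, d < δ → C * √d < η := by
  refine ⟨(η / (C + 1)) ^ 2, by positivity, fun d hd => ?_⟩
  have h₁ : √d < η / (C + 1) := (Real.sqrt_lt' (by positivity)).2 hd
  rw [lt_div_iff₀ (by positivity)] at h₁
  nlinarith [Real.sqrt_nonneg d]

theorem IsApprox.exists_u_limit {Finf M : ℝ} {u F : ℕ → ℝ → ℝ → ℝ} (h : IsApprox Finf M u F)
    (hconv : ∀ q r : ℚ, 0 ≤ q → ∃ l, Tendsto (fun k => u k q r) atTop (𝓝 l)) :
    ∃ v : ℝ → ℝ → ℝ, ∀ t, 0 ≤ t → ∀ x, Tendsto (fun k => u k t x) atTop (𝓝 (v t x)) := by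
  have key : ∀ t, 0 ≤ t → ∀ x, ∃ l, Tendsto (fun k => u k t x) atTop (𝓝 l) := by
    intro t ht x
    refine exists_tendsto_of_approx fun η hη => ?_
    obtain ⟨C, hC, ε, hε, H⟩ := h.exists_abs_sub_le (T := t + 1) (by positivity)
    obtain ⟨δ, hδ, hδη⟩ := exists_sqrt_lt hC (half_pos hη)
    obtain ⟨q, hq₁, hq₂⟩ := exists_rat_btwn (show t < t + min δ 1 by
      have := lt_min hδ one_pos; linarith)
    obtain ⟨r, hr₁, hr₂⟩ := exists_rat_btwn (show x < x + δ by linarith)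
    have hq0 : (0 : ℝ) ≤ q := ht.trans hq₁.le
    refine ⟨fun k => u k q r, hconv q r (by exact_mod_cast hq0), ?_⟩
    filter_upwards [hε.eventually (gt_mem_nhds (half_pos hη))] with k hk
    have hm₁ := min_le_left δ 1
    have hm₂ := min_le_right δ 1
    have hd : dist ((t, x) : ℝ × ℝ) (q, r) < δ := by
      rw [Prod.dist_eq, max_lt_iff, Real.dist_eq, Real.dist_eq, abs_lt, abs_lt]
      refine ⟨⟨?_, ?_⟩, ?_, ?_⟩ <;> simp only <;> linarith
    have := H k (t, x) ⟨⟨ht, by linarith⟩, mem_univ _⟩ (q, r)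
      ⟨⟨hq0, by linarith⟩, mem_univ _⟩
    linarith [hδη _ hd]
  choose! v hv using key
  exact ⟨v, hv⟩

/-! ### Lower limits of increasing functions -/

/-- The left continuous lower limit of a sequence of increasing functions. -/
noncomputable def lowerLimit (G : ℕ → ℝ → ℝ) (x : ℝ) : ℝ :=
  sSup {c | ∃ y < x, ∀ᶠ k in atTop, c ≤ G k y}

section LowerLimit

variable {G : ℕ → ℝ → ℝ} {A : ℝ}

theorem lowerLimit_bddAbove (hG : ∀ k x, G k x ∈ Icc 0 A) (x : ℝ) :
    BddAbove {c | ∃ y < x, ∀ᶠ k in atTop, c ≤ G k y} := by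
  refine ⟨A, ?_⟩
  rintro c ⟨y, -, hc⟩
  obtain ⟨k, hk⟩ := hc.exists
  exact hk.trans (hG k y).2

theorem lowerLimit_nonempty (hG : ∀ k x, G k x ∈ Icc 0 A) (x : ℝ) :
    {c | ∃ y < x, ∀ᶠ k in atTop, c ≤ G k y}.Nonempty :=
  ⟨0, x - 1, by linarith, Eventually.of_forall fun k => (hG k _).1⟩

theorem le_lowerLimit (hG : ∀ k x, G k x ∈ Icc 0 A) {x y c : ℝ} (hyx : y < x)
    (hc : ∀ᶠ k in atTop, c ≤ G k y) : c ≤ lowerLimit G x :=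
  le_csSup (lowerLimit_bddAbove hG x) ⟨y, hyx, hc⟩

theorem lowerLimit_le (hG : ∀ k x, G k x ∈ Icc 0 A) {x b : ℝ}
    (h : ∀ y < x, ∀ c, (∀ᶠ k in atTop, c ≤ G k y) → c ≤ b) : lowerLimit G x ≤ b :=
  csSup_le (lowerLimit_nonempty hG x) fun c ⟨y, hy, hc⟩ => h y hy c hc

theorem exists_of_lt_lowerLimit (hG : ∀ k x, G k x ∈ Icc 0 A) {x c : ℝ} (h : c < lowerLimit G x) :
    ∃ y < x, ∀ᶠ k in atTop, c ≤ G k y := by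
  obtain ⟨c', ⟨y, hy, hc'⟩, hcc'⟩ := exists_lt_of_lt_csSup (lowerLimit_nonempty hG x) h
  exact ⟨y, hy, hc'.mono fun k hk => hcc'.le.trans hk⟩

theorem lowerLimit_mem_Icc (hG : ∀ k x, G k x ∈ Icc 0 A) (x : ℝ) : lowerLimit G x ∈ Icc 0 A := by
  constructor
  · exact le_lowerLimit hG (sub_one_lt x) (Eventually.of_forall fun k => (hG k _).1)
  · refine lowerLimit_le hG fun y _ c hc => ?_
    obtain ⟨k, hk⟩ := hc.exists
    exact hk.trans (hG k y).2

theorem lowerLimit_mono (hG : ∀ k x, G k x ∈ Icc 0 A) : Monotone (lowerLimit G) := fun _ _ hxz =>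
  lowerLimit_le hG fun _ hy _ hc => le_lowerLimit hG (hy.trans_le hxz) hc

theorem lowerLimit_leftCont (hG : ∀ k x, G k x ∈ Icc 0 A) (x : ℝ) :
    ContinuousWithinAt (lowerLimit G) (Iic x) x := by
  rw [ContinuousWithinAt, tendsto_order]
  constructor
  · intro c hc
    obtain ⟨c', hc₁, hc₂⟩ := exists_between hc
    obtain ⟨y, hy, hyc⟩ := exists_of_lt_lowerLimit hG hc₂
    filter_upwards [mem_nhdsWithin_of_mem_nhds (Ioi_mem_nhds hy)] with z hz
    exact hc₁.trans_le (le_lowerLimit hG hz hyc)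
  · intro c hc
    filter_upwards [self_mem_nhdsWithin] with z hz
    exact (lowerLimit_mono hG hz).trans_lt hc

theorem eventually_le_of_lt_lowerLimit (hG : ∀ k x, G k x ∈ Icc 0 A) (hm : ∀ k, Monotone (G k))
    {x c : ℝ} (h : c < lowerLimit G x) : ∀ᶠ k in atTop, c ≤ G k x := by
  obtain ⟨y, hy, hc⟩ := exists_of_lt_lowerLimit hG h
  exact hc.mono fun k hk => hk.trans (hm k hy.le)

/-- The energy condition passes to the limit. -/
theorem energyPair_lowerLimit {v : ℕ → ℝ → ℝ} {u : ℝ → ℝ} (hG : ∀ k x, G k x ∈ Icc 0 A)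
    (hE : ∀ k, EnergyPair (v k) (G k)) (hu : Continuous u)
    (hv : ∀ x, Tendsto (fun k => v k x) atTop (𝓝 (u x))) : EnergyPair u (lowerLimit G) := by
  intro a b hab
  refine ⟨lowerLimit_mono hG hab, ?_⟩
  rcases hab.eq_or_lt with rfl | hlt
  · simp
  have hba : 0 < b - a := sub_pos.2 hlt
  -- Shifting both points left by `h` makes lower bounds suffice: those on `G k (b - h)` bound
  -- `lowerLimit G b` from below by definition. Left continuity then allows `h → 0`, so `G` need not
  -- converge.
  have key : ∀ h > 0, lowerLimit G (a - h) + (u (b - h) - u (a - h)) ^ 2 / (b - a) ≤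
      lowerLimit G b := by
    intro h hh
    refine le_of_forall_pos_lt_add fun η hη => ?_
    have h₁ := eventually_le_of_lt_lowerLimit hG (fun k => (hE k).monotone)
      (show lowerLimit G (a - h) - η / 4 < lowerLimit G (a - h) by linarith)
    have h₂ : Tendsto (fun k => (v k (b - h) - v k (a - h)) ^ 2 / (b - a)) atTop
        (𝓝 ((u (b - h) - u (a - h)) ^ 2 / (b - a))) :=
      (((hv _).sub (hv _)).pow 2).div_const _
    have h₃ := h₂.eventually (lt_mem_nhds (show (u (b - h) - u (a - h)) ^ 2 / (b - a) - η / 4 <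
      (u (b - h) - u (a - h)) ^ 2 / (b - a) by linarith))
    have := le_lowerLimit hG (show b - h < b by linarith)
      (c := lowerLimit G (a - h) + (u (b - h) - u (a - h)) ^ 2 / (b - a) - η / 2) (by
        filter_upwards [h₁, h₃] with k hk₁ hk₃
        have := (hE k (a - h) (b - h) (by linarith)).2
        rw [show b - h - (a - h) = b - a by ring] at this
        have h₄ : (v k (b - h) - v k (a - h)) ^ 2 / (b - a) ≤ G k (b - h) - G k (a - h) := by
          rw [div_le_iff₀ hba]; linarith
        linarith)
    linarith
  have hlim₀ : Tendsto (fun h : ℝ => a - h) (𝓝[>] 0) (𝓝[≤] a) := by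
    refine tendsto_nhdsWithin_iff.2 ⟨?_, ?_⟩
    · have : Tendsto (fun h : ℝ => a - h) (𝓝 0) (𝓝 (a - 0)) :=
        tendsto_const_nhds.sub tendsto_id
      rw [sub_zero] at this
      exact this.mono_left nhdsWithin_le_nhds
    · filter_upwards [self_mem_nhdsWithin] with h hh
      exact (sub_lt_self a hh).le
  have hlim₁ : Tendsto (fun h => lowerLimit G (a - h)) (𝓝[>] 0) (𝓝 (lowerLimit G a)) :=
    (lowerLimit_leftCont hG a).tendsto.comp hlim₀
  have hlim₂ : Tendsto (fun h => (u (b - h) - u (a - h)) ^ 2 / (b - a)) (𝓝[>] 0)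
      (𝓝 ((u b - u a) ^ 2 / (b - a))) := by
    have hc : Continuous fun h => (u (b - h) - u (a - h)) ^ 2 / (b - a) := by fun_prop
    have := hc.tendsto 0
    simp only [sub_zero] at this
    exact this.mono_left nhdsWithin_le_nhds
  have := le_of_tendsto (hlim₁.add hlim₂) (by
    filter_upwards [self_mem_nhdsWithin] with h hh using key h hh)
  have h₅ : (u b - u a) ^ 2 / (b - a) ≤ lowerLimit G b - lowerLimit G a := by linarith
  rw [div_le_iff₀ hba] at h₅
  linarith

/-- The strict inequality `d₀ < δ` makes the shifts `d k` eventually smaller than `δ`. -/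
theorem gClose_lowerLimit {G' : ℕ → ℝ → ℝ} (hG : ∀ k x, G k x ∈ Icc 0 A)
    (hG' : ∀ k x, G' k x ∈ Icc 0 A) (hm : ∀ k, Monotone (G k)) (hm' : ∀ k, Monotone (G' k))
    {d : ℕ → ℝ} {d₀ δ : ℝ} (hd : Tendsto d atTop (𝓝 d₀)) (hδ : d₀ < δ)
    (h : ∀ k, GClose (d k) (G k) (G' k)) : GClose δ (lowerLimit G) (lowerLimit G') := by
  have main : ∀ {G G' : ℕ → ℝ → ℝ}, (∀ k x, G k x ∈ Icc 0 A) → (∀ k x, G' k x ∈ Icc 0 A) →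
      (∀ k, Monotone (G' k)) → (∀ k, GClose (d k) (G k) (G' k)) → ∀ x,
      lowerLimit G x ≤ lowerLimit G' (x + δ) := by
    intro G G' hG hG' hm' h x
    refine lowerLimit_le hG fun y hy c hc => ?_
    refine le_lowerLimit hG' (show y + δ < x + δ by linarith) ?_
    filter_upwards [hc, hd.eventually (gt_mem_nhds hδ)] with k h₁ h₂
    have h₃ := (h k (y + d k)).1
    rw [add_sub_cancel_right] at h₃
    exact h₁.trans (h₃.trans (hm' k (by linarith)))
  intro x
  constructor
  · simpa using main hG hG' hm' h (x - δ)
  · exact main hG' hG hm (fun k => (h k).symm) x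

end LowerLimit


/-! ### Horizontal shifts and the `L¹` distance -/

/-- Increasing functions from `0` to `A` that are constant outside `[-R, R]`. -/
structure IsProfile (A R : ℝ) (G : ℝ → ℝ) : Prop where
  monotone : Monotone G
  mem_Icc : ∀ x, G x ∈ Icc 0 A
  eq_zero : ∀ x, x ≤ -R → G x = 0
  eq_top : ∀ x, R ≤ x → G x = A

theorem IsProfile.mono {A R R' : ℝ} {G : ℝ → ℝ} (h : IsProfile A R G) (hR : R ≤ R') :
    IsProfile A R' G :=
  ⟨h.monotone, h.mem_Icc, fun x hx => h.eq_zero x (by linarith), fun x hx => h.eq_top x (by linarith)⟩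

theorem IsProfile.sub_eq_zero {A R : ℝ} {G G' : ℝ → ℝ} (h : IsProfile A R G)
    (h' : IsProfile A R G') {x : ℝ} (hx : x ∉ Ioo (-R) R) : G x - G' x = 0 := by
  rw [mem_Ioo, not_and_or, not_lt, not_lt] at hx
  rcases hx with hx | hx
  · rw [h.eq_zero x hx, h'.eq_zero x hx, sub_zero]
  · rw [h.eq_top x hx, h'.eq_top x hx, sub_self]

theorem IsProfile.abs_sub_le {A R : ℝ} {G G' : ℝ → ℝ} (h : IsProfile A R G)
    (h' : IsProfile A R G') (x : ℝ) : |G x - G' x| ≤ A := by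
  have a := h.mem_Icc x
  have b := h'.mem_Icc x
  rw [abs_le]; constructor <;> linarith [a.1, a.2, b.1, b.2]

theorem IsProfile.integrable_sub {A R : ℝ} {G G' : ℝ → ℝ} (h : IsProfile A R G)
    (h' : IsProfile A R G') : Integrable (fun x => G x - G' x) volume := by
  have h₁ : IntegrableOn (fun x => G x - G' x) (Ioo (-R) R) volume :=
    Measure.integrableOn_of_bounded (M := A) (by simp)
      (h.monotone.measurable.sub h'.monotone.measurable).aestronglyMeasurable
      (Eventually.of_forall fun x => h.abs_sub_le h' x)
  exact h₁.integrable_of_forall_notMem_eq_zero fun x hx => h.sub_eq_zero h' hx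

/-- The difference is squeezed by `G (x + δ) - G (x - δ)`, whose integral telescopes to integrals
over two end intervals of length `2 δ`. -/
theorem IsProfile.integral_abs_sub_le {A R δ : ℝ} {G G' : ℝ → ℝ} (h : IsProfile A R G)
    (h' : IsProfile A R G') (hδ : 0 ≤ δ) (hc : GClose δ G G') :
    ∫ x, |G' x - G x| ≤ 2 * δ * A := by
  -- For negative `R` the two constant regions overlap, which forces `A = 0`.
  rcases lt_or_ge R 0 with hR | hR
  · have hA : A = 0 := by rw [← h.eq_top 0 hR.le, h.eq_zero 0 (by linarith)]
    have : ∀ x, |G' x - G x| = 0 := fun x =>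
      le_antisymm (hA ▸ h'.abs_sub_le h x) (abs_nonneg _)
    simp [this, hA]
  have hi : ∀ a b, IntervalIntegrable G volume a b := fun a b =>
    h.monotone.intervalIntegrable
  have s₁ : IsProfile A (R + δ) (fun x => G (x + δ)) :=
    ⟨fun x y hxy => h.monotone (by linarith), fun x => h.mem_Icc _,
      fun x hx => h.eq_zero _ (by linarith), fun x hx => h.eq_top _ (by linarith)⟩
  have s₂ : IsProfile A (R + δ) (fun x => G (x - δ)) :=
    ⟨fun x y hxy => h.monotone (by linarith), fun x => h.mem_Icc _,
      fun x hx => h.eq_zero _ (by linarith), fun x hx => h.eq_top _ (by linarith)⟩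
  calc ∫ x, |G' x - G x| ≤ ∫ x, (G (x + δ) - G (x - δ)) := by
        refine integral_mono (h'.integrable_sub h).abs (s₁.integrable_sub s₂) fun x => ?_
        have c := hc x
        have c₁ : G (x - δ) ≤ G x := h.monotone (by linarith)
        have c₂ : G x ≤ G (x + δ) := h.monotone (by linarith)
        rw [abs_le]; constructor <;> linarith [c.1, c.2]
    _ = ∫ x in (-(R + δ))..(R + δ), (G (x + δ) - G (x - δ)) := by
        symm
        refine intervalIntegral.integral_eq_integral_of_support_subset fun x hx => ?_
        by_contra hx'
        exact hx (s₁.sub_eq_zero s₂ fun h => hx' (Ioo_subset_Ioc_self h))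
    _ = (∫ x in R..(R + δ + δ), G x) - ∫ x in (-(R + δ) - δ)..(-R), G x := by
        rw [intervalIntegral.integral_sub, intervalIntegral.integral_comp_add_right,
          intervalIntegral.integral_comp_sub_right,
          intervalIntegral.integral_interval_sub_interval_comm (hi _ _) (hi _ _) (hi _ _)]
        · rw [intervalIntegral.integral_symm (-(R + δ) - δ), intervalIntegral.integral_symm
            (R + δ - δ) (R + δ + δ)]
          rw [show -(R + δ) + δ = -R by ring, add_sub_cancel_right]
          ring
        · exact s₁.monotone.intervalIntegrable
        · exact s₂.monotone.intervalIntegrable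
    _ ≤ ∫ x in R..(R + δ + δ), G x := by
        rw [sub_le_self_iff]
        exact intervalIntegral.integral_nonneg (by linarith) fun x _ => (h.mem_Icc x).1
    _ ≤ ∫ _ in R..(R + δ + δ), A :=
        intervalIntegral.integral_mono_on (by linarith) (hi _ _) intervalIntegrable_const
          fun x _ => (h.mem_Icc x).2
    _ = 2 * δ * A := by rw [intervalIntegral.integral_const, smul_eq_mul]; ring

theorem IsProfile.tendsto_integral_abs_sub {A R : ℝ} {G : ℕ → ℝ → ℝ} {G₀ : ℝ → ℝ}
    (h : ∀ k, IsProfile A R (G k)) (h₀ : IsProfile A R G₀)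
    (hlim : ∀ᵐ x, Tendsto (fun k => G k x) atTop (𝓝 (G₀ x))) :
    Tendsto (fun k => ∫ x, |G k x - G₀ x|) atTop (𝓝 0) := by
  have : Tendsto (fun k => ∫ x, |G k x - G₀ x|) atTop (𝓝 (∫ _ : ℝ, (0 : ℝ))) := by
    refine tendsto_integral_of_dominated_convergence ((Ioo (-R) R).indicator fun _ => A)
      (fun k => ((h k).integrable_sub h₀).abs.aestronglyMeasurable) ?_ (fun k => ?_) ?_
    · exact (integrable_indicator_iff measurableSet_Ioo).2 (integrableOn_const (by simp))
    · refine Eventually.of_forall fun x => ?_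
      by_cases hx : x ∈ Ioo (-R) R
      · rw [indicator_of_mem hx, Real.norm_eq_abs, abs_abs]
        exact (h k).abs_sub_le h₀ x
      · rw [indicator_of_notMem hx, (h k).sub_eq_zero h₀ hx]; simp
    · filter_upwards [hlim] with x hx
      simpa using (hx.sub_const (G₀ x)).abs
  simpa using this

theorem eLpNorm_one_eq_ofReal {f : ℝ → ℝ} (hf : Integrable f volume) :
    eLpNorm f 1 volume = ENNReal.ofReal (∫ x, |f x|) := by
  rw [eLpNorm_one_eq_lintegral_enorm, ← ofReal_integral_norm_eq_lintegral_enorm hf]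
  rfl

theorem contL1_of_lipschitz {T K : ℝ} {G : ℝ → ℝ → ℝ}
    (h : ∀ s t, 0 ≤ s → s ≤ t → t ≤ T → Integrable (fun x => G t x - G s x) volume ∧
      ∫ x, |G t x - G s x| ≤ K * (t - s)) : ContL1 T G := by
  have hsymm : ∀ s ∈ Icc 0 T, ∀ t ∈ Icc 0 T, Integrable (fun x => G t x - G s x) volume ∧
      ∫ x, |G t x - G s x| ≤ K * |t - s| := by
    intro s hs t ht
    rcases le_total s t with hst | hst
    · rw [abs_of_nonneg (sub_nonneg.2 hst)]
      exact h s t hs.1 hst ht.2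
    · obtain ⟨h₁, h₂⟩ := h t s ht.1 hst hs.2
      refine ⟨h₁.neg.congr (Eventually.of_forall fun x => by simp), ?_⟩
      rw [abs_sub_comm, abs_of_nonneg (sub_nonneg.2 hst)]
      simpa only [abs_sub_comm] using h₂
  intro s hs
  refine ⟨fun t ht => (hsymm s hs t ht).1, ?_⟩
  have h₁ : Tendsto (fun t => ENNReal.ofReal (K * |t - s|)) (𝓝[Icc 0 T] s) (𝓝 0) := by
    have hc : Continuous fun t => ENNReal.ofReal (K * |t - s|) :=
      ENNReal.continuous_ofReal.comp (by fun_prop)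
    have := hc.tendsto s
    simp only [sub_self, abs_zero, mul_zero, ENNReal.ofReal_zero] at this
    exact this.mono_left nhdsWithin_le_nhds
  refine tendsto_of_tendsto_of_tendsto_of_le_of_le' tendsto_const_nhds h₁
    (Eventually.of_forall fun _ => zero_le) ?_
  filter_upwards [self_mem_nhdsWithin] with t ht
  obtain ⟨h₂, h₃⟩ := hsymm s hs t ht
  rw [eLpNorm_one_eq_ofReal h₂]
  exact ENNReal.ofReal_le_ofReal h₃

/-! ### Convergence of `F` -/

namespace IsApprox

variable {Finf M : ℝ} {u F : ℕ → ℝ → ℝ → ℝ}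

/-- The lower bound is built into the definition. For the upper one, a rational point `(q, r)`
slightly later and to the right is compared horizontally: `F k t x ≤ F k q r ≤ F k t (r + g)`.
Convergence at `(q, r)` bounds its limit by `lowerLimit` at `z`, and continuity at `x` allows a
suitable `z > x`. -/
theorem tendsto_lowerLimit (h : IsApprox Finf M u F)
    (hconv : ∀ q r : ℚ, 0 ≤ q → ∃ l, Tendsto (fun k => F k q r) atTop (𝓝 l)) {t : ℝ} (ht : 0 ≤ t)
    {x : ℝ} (hx : ContinuousAt (lowerLimit fun k => F k t) x) :
    Tendsto (fun k => F k t x) atTop (𝓝 (lowerLimit (fun k => F k t) x)) := by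
  have hG : ∀ k x, F k t x ∈ Icc 0 Finf := fun k => (h.state k t ht).mem_Icc
  have hm : ∀ k, Monotone (F k t) := fun k => (h.state k t ht).energy.monotone
  rw [tendsto_order]
  constructor
  · intro c hc
    obtain ⟨c', h₁, h₂⟩ := exists_between hc
    filter_upwards [eventually_le_of_lt_lowerLimit hG hm h₂] with k hk
    exact h₁.trans_le hk
  · intro c hc
    obtain ⟨c', hc₁, hc₂⟩ := exists_between hc
    obtain ⟨z, hxz, hz⟩ : ∃ z, x < z ∧ lowerLimit (fun k => F k t) z < c' := by
      have h₁ : ∀ᶠ z in 𝓝[>] x, lowerLimit (fun k => F k t) z < c' :=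
        nhdsWithin_le_nhds (hx.eventually (gt_mem_nhds hc₁))
      obtain ⟨z, hz₁, hz₂⟩ := (h₁.and self_mem_nhdsWithin).exists
      exact ⟨z, hz₂, hz₁⟩
    obtain ⟨C, hC, ε, hε, H⟩ := h.modulus (t + 1) (by positivity)
    -- A quarter of the gap gives `x + g < r` and `r + g < z`; the shift stays below `g`, half from
    -- `C (q - t)` and half from `ε k`.
    set g := (z - x) / 4 with hg
    have hg0 : 0 < g := by rw [hg]; linarith
    obtain ⟨r, hr₁, hr₂⟩ := exists_rat_btwn (show x + g < x + 2 * g by linarith)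
    obtain ⟨q, hq₁, hq₂⟩ := exists_rat_btwn (show t < t + min 1 (g / (2 * (C + 1))) by
      have : 0 < min 1 (g / (2 * (C + 1))) := by positivity
      linarith)
    have hq1 : (q : ℝ) ≤ t + 1 := by linarith [min_le_left 1 (g / (2 * (C + 1)))]
    have hq0 : (0 : ℝ) ≤ q := ht.trans hq₁.le
    have hqg : C * (q - t) ≤ g / 2 := by
      have h₁ : (q : ℝ) - t ≤ g / (2 * (C + 1)) := by
        linarith [min_le_right 1 (g / (2 * (C + 1)))]
      rw [le_div_iff₀ (by positivity)] at h₁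
      nlinarith
    have hmq : ∀ k, Monotone (F k q) := fun k => (h.state k q hq0).energy.monotone
    obtain ⟨l, hl⟩ := hconv q r (by exact_mod_cast hq0)
    have hclose : ∀ᶠ k in atTop, F k t x ≤ F k q r ∧ F k q r ≤ F k t (r + g) := by
      filter_upwards [hε.eventually (gt_mem_nhds (half_pos hg0))] with k hk
      have hcl := (H k t q ht hq₁.le hq1).1
      refine ⟨((hcl.symm x).2).trans (hmq k (by linarith)), ((hcl r).2).trans (hm k (by linarith))⟩
    have hlz : l ≤ lowerLimit (fun k => F k t) z := by
      refine le_of_forall_pos_lt_add fun η hη => ?_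
      have := le_lowerLimit hG (show (r : ℝ) + g < z by linarith) (c := l - η / 2) (by
        filter_upwards [hclose, hl.eventually (lt_mem_nhds (show l - η / 2 < l by linarith))]
          with k h₁ h₂
        exact h₂.le.trans h₁.2)
      linarith
    filter_upwards [hclose, hl.eventually (gt_mem_nhds (hlz.trans_lt (hz.trans hc₂)))] with k h₁ h₂
    exact h₁.1.trans_lt h₂

theorem ae_tendsto (h : IsApprox Finf M u F)
    (hconv : ∀ q r : ℚ, 0 ≤ q → ∃ l, Tendsto (fun k => F k q r) atTop (𝓝 l)) {t : ℝ}
    (ht : 0 ≤ t) :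
    ∀ᵐ x, Tendsto (fun k => F k t x) atTop (𝓝 (lowerLimit (fun k => F k t) x)) := by
  have hG : ∀ k x, F k t x ∈ Icc 0 Finf := fun k => (h.state k t ht).mem_Icc
  have h₁ := (lowerLimit_mono hG).countable_not_continuousAt.ae_notMem volume
  filter_upwards [h₁] with x hx
  exact h.tendsto_lowerLimit hconv ht (not_not.1 hx)

theorem exists_isProfile (h : IsApprox Finf M u F) {T : ℝ} (hT : 0 < T) :
    ∃ R, 0 ≤ R ∧ ∀ t, 0 ≤ t → t ≤ T → (∀ k, IsProfile Finf R (F k t)) ∧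
      IsProfile Finf R (lowerLimit fun k => F k t) := by
  obtain ⟨R, hR, H⟩ := h.support T hT
  -- At `x`, `lowerLimit` sees only points strictly to the left; the extra `1` lets `R` itself be
  -- such a point.
  refine ⟨R + 1, by positivity, fun t ht htT => ?_⟩
  have hG : ∀ k x, F k t x ∈ Icc 0 Finf := fun k => (h.state k t ht).mem_Icc
  have hprof : ∀ k, IsProfile Finf R (F k t) := fun k =>
    ⟨(h.state k t ht).energy.monotone, hG k, (H k t ht htT).1, (H k t ht htT).2⟩
  refine ⟨fun k => (hprof k).mono (by linarith), lowerLimit_mono hG, lowerLimit_mem_Icc hG,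
    fun x hx => ?_, fun x hx => ?_⟩
  · refine le_antisymm (lowerLimit_le hG fun y hy c hc => ?_) (lowerLimit_mem_Icc hG x).1
    obtain ⟨k, hk⟩ := hc.exists
    rwa [(hprof k).eq_zero y (by linarith)] at hk
  · refine le_antisymm (lowerLimit_mem_Icc hG x).2 ?_
    exact le_lowerLimit hG (show R < x by linarith)
      (Eventually.of_forall fun k => ((hprof k).eq_top R le_rfl).ge)

theorem exists_integral_abs_sub_le (h : IsApprox Finf M u F) {T : ℝ} (hT : 0 < T) :
    ∃ C, 0 ≤ C ∧ ∃ ε : ℕ → ℝ, Tendsto ε atTop (𝓝 0) ∧ ∀ s t, 0 ≤ s → s ≤ t → t ≤ T →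
      (∀ k, ∫ x, |F k t x - F k s x| ≤ C * (t - s) + ε k) ∧
      ∫ x, |lowerLimit (fun k => F k t) x - lowerLimit (fun k => F k s) x| ≤ C * (t - s) := by
  obtain ⟨C, hC, ε, hε, H⟩ := h.modulus T hT
  obtain ⟨R, hR, hprof⟩ := h.exists_isProfile hT
  have hF : 0 ≤ Finf := ((h.state 0 0 le_rfl).mem_Icc 0).1.trans ((h.state 0 0 le_rfl).mem_Icc 0).2
  refine ⟨2 * (C + 1) * Finf, by positivity, fun k => 2 * |ε k| * Finf, ?_, ?_⟩
  · simpa using (hε.abs.const_mul 2).mul_const Finf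
  intro s t hs hst htT
  have ht := hs.trans hst
  have hts : 0 ≤ t - s := sub_nonneg.2 hst
  constructor
  · intro k
    have hδ : C * (t - s) + ε k ≤ (C + 1) * (t - s) + |ε k| := by
      linarith [le_abs_self (ε k)]
    have h₁ := ((H k s t hs hst htT).1).mono (h.state k s hs).energy.monotone hδ
    have h₂ := ((hprof s hs (hst.trans htT)).1 k).integral_abs_sub_le ((hprof t ht htT).1 k)
      (by positivity) h₁
    linarith
  · rcases hst.eq_or_lt with rfl | hlt
    · simp
    -- `C + 1` replaces `C` because the shift must strictly exceed the limit `C (t - s)` of the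
    -- approximate shifts.
    have h₁ : GClose ((C + 1) * (t - s)) (lowerLimit fun k => F k s) (lowerLimit fun k => F k t) :=
      gClose_lowerLimit (fun k => (h.state k s hs).mem_Icc) (fun k => (h.state k t ht).mem_Icc)
        (fun k => (h.state k s hs).energy.monotone) (fun k => (h.state k t ht).energy.monotone)
        (hε.const_add (C * (t - s))) (by linarith) (fun k => (H k s t hs hst htT).1)
    have h₂ := (hprof s hs (hst.trans htT)).2.integral_abs_sub_le (hprof t ht htT).2
      (by positivity) h₁
    linarith

/-- At each fixed time dominated convergence applies; the `L¹` moduli in time and compactness of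
`[0, T]` make the convergence uniform. -/
theorem tendstoCL1 (h : IsApprox Finf M u F)
    (hconv : ∀ q r : ℚ, 0 ≤ q → ∃ l, Tendsto (fun k => F k q r) atTop (𝓝 l)) {T : ℝ} (hT : 0 < T)
    (hcont : ∀ k, ContL1 T (F k)) : TendstoCL1 T F fun t => lowerLimit fun k => F k t := by
  obtain ⟨R, hR, hprof⟩ := h.exists_isProfile hT
  obtain ⟨C, hC, ε, hε, H⟩ := h.exists_integral_abs_sub_le hT
  have hint : ∀ k, ∀ t ∈ Icc 0 T,
      Integrable (fun x => F k t x - lowerLimit (fun k => F k t) x) volume := fun k t ht =>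
    ((hprof t ht.1 ht.2).1 k).integrable_sub (hprof t ht.1 ht.2).2
  refine ⟨hcont, contL1_of_lipschitz (K := C) fun s t hs hst htT => ⟨?_, ?_⟩, hint, ?_⟩
  · exact (hprof t (hs.trans hst) htT).2.integrable_sub (hprof s hs (hst.trans htT)).2
  · exact (H s t hs hst htT).2
  have hHs : ∀ s ∈ Icc 0 T, ∀ t ∈ Icc 0 T,
      (∀ k, ∫ x, |F k t x - F k s x| ≤ C * dist t s + ε k) ∧
      ∫ x, |lowerLimit (fun k => F k t) x - lowerLimit (fun k => F k s) x| ≤ C * dist t s := by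
    intro s hs t ht
    rcases le_total s t with hst | hst
    · rw [Real.dist_eq, abs_of_nonneg (sub_nonneg.2 hst)]
      exact H s t hs.1 hst ht.2
    · rw [dist_comm, Real.dist_eq, abs_of_nonneg (sub_nonneg.2 hst)]
      obtain ⟨h₁, h₂⟩ := H t s ht.1 hst hs.2
      exact ⟨fun k => by simpa only [abs_sub_comm] using h₁ k,
        by simpa only [abs_sub_comm] using h₂⟩
  have key : ∀ η > 0, ∀ᶠ k in atTop, ∀ t ∈ Icc 0 T,
      ∫ x, |F k t x - lowerLimit (fun k => F k t) x| ≤ η := by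
    intro η hη
    refine eventually_le_of_equicontinuous (isCompact_Icc (a := (0 : ℝ)) (b := T))
      (h := fun k t => ∫ x, |F k t x - lowerLimit (fun k => F k t) x|) (fun t ht => ?_) ?_ hη
    · exact IsProfile.tendsto_integral_abs_sub (hprof t ht.1 ht.2).1 (hprof t ht.1 ht.2).2
        (h.ae_tendsto hconv ht.1)
    · intro η hη
      refine ⟨η / (4 * (C + 1)), by positivity, ?_⟩
      filter_upwards [hε.eventually (gt_mem_nhds (half_pos hη))] with k hk t ht s hs hd
      obtain ⟨h₁, h₂⟩ := hHs s hs t ht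
      have hpt := hprof t ht.1 ht.2
      have hps := hprof s hs.1 hs.2
      have i₁ := ((hpt.1 k).integrable_sub (hps.1 k)).abs
      have i₂ := (hint k s hs).abs
      have i₃ := (hpt.2.integrable_sub hps.2).abs
      have hle : ∫ x, |F k t x - lowerLimit (fun k => F k t) x| ≤
          (∫ x, |F k t x - F k s x|) + (∫ x, |F k s x - lowerLimit (fun k => F k s) x|) +
            ∫ x, |lowerLimit (fun k => F k t) x - lowerLimit (fun k => F k s) x| := by
        have i₄ : Integrable (fun x => |F k t x - F k s x| +
            |F k s x - lowerLimit (fun k => F k s) x|) volume := i₁.add i₂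
        rw [← integral_add i₁ i₂, ← integral_add i₄ i₃]
        refine integral_mono (hint k t ht).abs (i₄.add i₃) fun x => ?_
        have a₁ := abs_sub_le (F k t x) (F k s x) (lowerLimit (fun k => F k t) x)
        have a₂ := abs_sub_le (F k s x) (lowerLimit (fun k => F k s) x)
          (lowerLimit (fun k => F k t) x)
        rw [abs_sub_comm (lowerLimit (fun k => F k s) x)] at a₂
        simp only
        linarith
      have hd' : C * dist t s ≤ η / 4 := by
        rw [lt_div_iff₀ (by positivity)] at hd
        nlinarith [dist_nonneg (x := t) (y := s)]
      linarith [h₁ k]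
  rw [ENNReal.tendsto_nhds_zero]
  intro η hη
  rcases eq_or_ne η ∞ with rfl | hηt
  · exact Eventually.of_forall fun _ => le_top
  filter_upwards [key η.toReal (ENNReal.toReal_pos hη.ne' hηt)] with k hk
  refine iSup₂_le fun t ht => ?_
  rw [eLpNorm_one_eq_ofReal (hint k t ht)]
  exact ENNReal.ofReal_le_of_le_toReal (hk t ht)

end IsApprox


/-! ### Uniform convergence of `u` and properties of the limit -/

/-- Where `F` is flat, `u` is constant. Outside `[-R, R]` this reduces uniform convergence on the
whole line to a compact set. -/
theorem EnergyPair.eq_of_eq {u F : ℝ → ℝ} (h : EnergyPair u F) {x y : ℝ} (hF : F x = F y) :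
    u x = u y := by
  wlog hyx : y ≤ x generalizing x y
  · exact (this hF.symm (le_of_not_ge hyx)).symm
  have := (h y x hyx).2
  rw [hF, sub_self, mul_zero] at this
  exact sub_eq_zero.1 (pow_eq_zero_iff two_ne_zero |>.1 (le_antisymm this (sq_nonneg _)))

namespace IsApprox

variable {Finf M : ℝ} {u F : ℕ → ℝ → ℝ → ℝ} {v : ℝ → ℝ → ℝ}

theorem exists_limit_modulus (h : IsApprox Finf M u F)
    (hv : ∀ t, 0 ≤ t → ∀ x, Tendsto (fun k => u k t x) atTop (𝓝 (v t x))) {T : ℝ} (hT : 0 < T) :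
    ∃ C, 0 ≤ C ∧ ∀ p ∈ Icc 0 T ×ˢ (univ : Set ℝ), ∀ q ∈ Icc 0 T ×ˢ (univ : Set ℝ),
      |v p.1 p.2 - v q.1 q.2| ≤ C * √(dist p q) := by
  obtain ⟨C, hC, ε, hε, H⟩ := h.exists_abs_sub_le hT
  refine ⟨C, hC, fun p hp q hq => ?_⟩
  have h₁ := hε.const_add (C * √(dist p q))
  rw [add_zero] at h₁
  exact le_of_tendsto_of_tendsto' ((hv _ hp.1.1 _).sub (hv _ hq.1.1 _)).abs h₁
    fun k => H k p hp q hq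

theorem tendstoUniformlyOn (h : IsApprox Finf M u F)
    (hv : ∀ t, 0 ≤ t → ∀ x, Tendsto (fun k => u k t x) atTop (𝓝 (v t x))) {T : ℝ} (hT : 0 < T) :
    TendstoUniformlyOn (fun k (p : ℝ × ℝ) => u k p.1 p.2) (fun p => v p.1 p.2) atTop
      (Icc 0 T ×ˢ univ) := by
  obtain ⟨C, hC, ε, hε, H⟩ := h.exists_abs_sub_le hT
  obtain ⟨C', hC', H'⟩ := h.exists_limit_modulus hv hT
  obtain ⟨R, hR, hprof⟩ := h.exists_isProfile hT
  have hclamp : ∀ t ∈ Icc 0 T, ∀ x, ∃ y ∈ Icc (-R) R, (∀ k, u k t x = u k t y) ∧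
      v t x = v t y := by
    intro t ht x
    have key : ∃ y ∈ Icc (-R) R, ∀ k, u k t x = u k t y := by
      have hp := (hprof t ht.1 ht.2).1
      rcases lt_or_ge x (-R) with hx | hx
      · exact ⟨-R, ⟨le_rfl, by linarith⟩, fun k => (h.state k t ht.1).energy.eq_of_eq
          (((hp k).eq_zero x hx.le).trans ((hp k).eq_zero _ le_rfl).symm)⟩
      rcases lt_or_ge R x with hx' | hx'
      · exact ⟨R, ⟨by linarith, le_rfl⟩, fun k => (h.state k t ht.1).energy.eq_of_eq
          (((hp k).eq_top x hx'.le).trans ((hp k).eq_top _ le_rfl).symm)⟩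
      exact ⟨x, ⟨hx, hx'⟩, fun _ => rfl⟩
    obtain ⟨y, hy, hk⟩ := key
    exact ⟨y, hy, hk, tendsto_nhds_unique (hv t ht.1 x) ((hv t ht.1 y).congr fun k => (hk k).symm)⟩
  have hsub : Icc 0 T ×ˢ Icc (-R) R ⊆ Icc 0 T ×ˢ (univ : Set ℝ) :=
    prod_mono_right (subset_univ _)
  rw [Metric.tendstoUniformlyOn_iff]
  intro η hη
  have key := eventually_le_of_equicontinuous
    (isCompact_Icc.prod isCompact_Icc : IsCompact (Icc 0 T ×ˢ Icc (-R) R))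
    (h := fun k p => |u k p.1 p.2 - v p.1 p.2|) (fun p hp => by
      simpa using ((hv p.1 hp.1.1 p.2).sub_const (v p.1 p.2)).abs) (by
      intro η hη
      obtain ⟨δ, hδ, hδη⟩ := exists_sqrt_lt (add_nonneg hC hC') (half_pos hη)
      refine ⟨δ, hδ, ?_⟩
      filter_upwards [hε.eventually (gt_mem_nhds (half_pos hη))] with k hk p hp q hq hpq
      have h₁ := H k p (hsub hp) q (hsub hq)
      have h₂ := H' q (hsub hq) p (hsub hp)
      rw [dist_comm] at h₂
      have h₃ := hδη _ hpq
      have h₄ := abs_sub_le (u k p.1 p.2) (u k q.1 q.2) (v p.1 p.2)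
      have h₅ := abs_sub_le (u k q.1 q.2) (v q.1 q.2) (v p.1 p.2)
      linarith) (half_pos hη)
  filter_upwards [key] with k hk
  rintro ⟨t, x⟩ ⟨ht, -⟩
  obtain ⟨y, hy, h₁, h₂⟩ := hclamp t ht x
  simp only
  rw [h₁ k, h₂, dist_comm, Real.dist_eq]
  exact (hk (t, y) ⟨ht, hy⟩).trans_lt (by linarith)

theorem holderOnWith (h : IsApprox Finf M u F)
    (hv : ∀ t, 0 ≤ t → ∀ x, Tendsto (fun k => u k t x) atTop (𝓝 (v t x))) {T : ℝ} (hT : 0 < T) :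
    ∃ C : ℝ≥0, HolderOnWith C (1 / 2) (fun p : ℝ × ℝ => v p.1 p.2) (Icc 0 T ×ˢ univ) := by
  obtain ⟨C, hC, H⟩ := h.exists_limit_modulus hv hT
  refine ⟨⟨C, hC⟩, fun p hp q hq => ?_⟩
  have h₁ := H p hp q hq
  rw [Real.sqrt_eq_rpow] at h₁
  rw [edist_dist, edist_dist, Real.dist_eq]
  refine (ENNReal.ofReal_le_ofReal h₁).trans_eq ?_
  rw [ENNReal.ofReal_mul hC, ENNReal.ofReal_rpow_of_nonneg dist_nonneg (by positivity)]
  congr 1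
  exact ENNReal.ofReal_eq_coe_nnreal hC

theorem abs_limit_le (h : IsApprox Finf M u F)
    (hv : ∀ t, 0 ≤ t → ∀ x, Tendsto (fun k => u k t x) atTop (𝓝 (v t x))) {t : ℝ} (ht : 0 ≤ t)
    (x : ℝ) : |v t x| ≤ M + 1 / 4 * Finf * t :=
  le_of_tendsto (hv t ht x).abs (Eventually.of_forall fun k => (h.state k t ht).abs_fst_le x)

theorem memD_limit (h : IsApprox Finf M u F)
    (hv : ∀ t, 0 ≤ t → ∀ x, Tendsto (fun k => u k t x) atTop (𝓝 (v t x))) {t : ℝ} (ht : 0 ≤ t) :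
    MemD Finf (v t) (lowerLimit fun k => F k t) := by
  have hT : 0 < t + 1 := by positivity
  obtain ⟨R, hR, hprof⟩ := h.exists_isProfile hT
  have hp := (hprof t ht (by linarith)).2
  have hG : ∀ k x, F k t x ∈ Icc 0 Finf := fun k => (h.state k t ht).mem_Icc
  have hcont : Continuous (v t) := by
    obtain ⟨C, hC, H⟩ := h.exists_limit_modulus hv hT
    rw [Metric.continuous_iff]
    intro x η hη
    obtain ⟨δ, hδ, hδη⟩ := exists_sqrt_lt hC hη
    refine ⟨δ, hδ, fun y hy => ?_⟩
    have h₁ := H (t, y) ⟨⟨ht, by linarith⟩, mem_univ _⟩ (t, x) ⟨⟨ht, by linarith⟩, mem_univ _⟩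
    have h₂ : dist ((t, y) : ℝ × ℝ) (t, x) = dist y x := by simp [Prod.dist_eq]
    rw [h₂] at h₁
    exact h₁.trans_lt (hδη _ hy)
  exact memD_of_energyPair (energyPair_lowerLimit hG (fun k => (h.state k t ht).energy) hcont
    (hv t ht)) hp.mem_Icc (h.abs_limit_le hv ht) (lowerLimit_leftCont hG) hp.eq_zero hp.eq_top

end IsApprox

/-! ### The numerical solutions satisfy the compactness hypotheses -/

theorem sqrt_add_le_sqrt_add_sqrt {a b : ℝ} (ha : 0 ≤ a) (hb : 0 ≤ b) : √(a + b) ≤ √a + √b := by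
  rw [Real.sqrt_le_left (by positivity)]
  nlinarith [Real.sq_sqrt ha, Real.sq_sqrt hb, Real.sqrt_nonneg a, Real.sqrt_nonneg b,
    mul_nonneg (Real.sqrt_nonneg a) (Real.sqrt_nonneg b)]

theorem tendsto_timeStep {dx : ℕ → ℝ} (Finf : ℝ) (hdx : Tendsto dx atTop (𝓝 0)) :
    Tendsto (fun k => timeStep (dx k) Finf) atTop (𝓝 0) := by
  have := (hdx.sqrt).div_const (2 * √Finf)
  simpa [timeStep] using this

section Numerical

variable {Finf M R₀ : ℝ} {u₀ F₀ : ℝ → ℝ}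

theorem isProfile_FNum {dx : ℝ} (hdx : 0 < dx) (hF : 0 < Finf)
    (hw : IsState Finf M (u₀, F₀)) (hbot : ∀ x, x ≤ -R₀ → F₀ x = 0)
    (htop : ∀ x, R₀ ≤ x → F₀ x = Finf) {T R : ℝ}
    (hR : R₀ + (dx + 3 * ((M + 1 / 4 * Finf * T + 4 * Finf * timeStep dx Finf) *
      (T + timeStep dx Finf))) ≤ R) {t : ℝ} (ht : 0 ≤ t) (htT : t ≤ T) :
    IsProfile Finf R (FNum Finf u₀ F₀ dx t) := by
  have hp := timeStep_pos hdx hF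
  have hM : 0 ≤ M := (abs_nonneg _).trans (hw.abs_fst_le 0)
  have hT : 0 ≤ T := ht.trans htT
  have hs := isState_numSol hdx hF hw ht
  have hc : GClose (R - R₀) F₀ (FNum Finf u₀ F₀ dx t) := by
    refine (gClose_initial hdx hF hw ht htT).mono hw.energy.monotone ?_
    have : (M + 1 / 4 * Finf * T + 4 * Finf * timeStep dx Finf) * (t + timeStep dx Finf) ≤
        (M + 1 / 4 * Finf * T + 4 * Finf * timeStep dx Finf) * (T + timeStep dx Finf) := by
      gcongr
    linarith
  refine ⟨hs.energy.monotone, hs.mem_Icc, fun x hx => ?_, fun x hx => ?_⟩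
  · refine le_antisymm ?_ (hs.mem_Icc x).1
    have := (hc x).2
    rwa [hbot _ (by linarith)] at this
  · refine le_antisymm (hs.mem_Icc x).2 ?_
    have := (hc x).1
    rwa [htop _ (by linarith)] at this

/-- The Lipschitz constant contains `1 / Δx` and is not uniform in the mesh; only continuity for
each mesh size is needed. -/
theorem contL1_FNum {dx : ℝ} (hdx : 0 < dx) (hF : 0 < Finf)
    (hw : IsState Finf M (u₀, F₀)) (hbot : ∀ x, x ≤ -R₀ → F₀ x = 0)
    (htop : ∀ x, R₀ ≤ x → F₀ x = Finf) (T : ℝ) : ContL1 T (FNum Finf u₀ F₀ dx) := by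
  set R := R₀ + (dx + 3 * ((M + 1 / 4 * Finf * T + 4 * Finf * timeStep dx Finf) *
      (T + timeStep dx Finf)))
  set K := Finf / (dx / 2) * (M + 1 / 4 * Finf * (T + timeStep dx Finf))
  refine contL1_of_lipschitz (K := K * volume.real (Ioo (-R) R)) fun s t hs hst htT => ?_
  have hp : ∀ r, 0 ≤ r → r ≤ T → IsProfile Finf R (FNum Finf u₀ F₀ dx r) := fun r hr hrT =>
    isProfile_FNum hdx hF hw hbot htop le_rfl hr hrT
  have h₁ := hp s hs (hst.trans htT)
  have h₂ := hp t (hs.trans hst) htT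
  refine ⟨h₂.integrable_sub h₁, ?_⟩
  have hlip : ∀ x, |FNum Finf u₀ F₀ dx t x - FNum Finf u₀ F₀ dx s x| ≤ K * (t - s) :=
    abs_numSol_sub_le hdx hF hw hs hst htT
  calc ∫ x, |FNum Finf u₀ F₀ dx t x - FNum Finf u₀ F₀ dx s x|
      ≤ ∫ x, (Ioo (-R) R).indicator (fun _ => K * (t - s)) x := by
        refine integral_mono (h₂.integrable_sub h₁).abs
          ((integrable_indicator_iff measurableSet_Ioo).2 (integrableOn_const (by simp)))
          fun x => ?_
        by_cases hx : x ∈ Ioo (-R) R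
        · simpa only [indicator_of_mem hx] using hlip x
        · simp [indicator_of_notMem hx, h₂.sub_eq_zero h₁ hx]
    _ = K * volume.real (Ioo (-R) R) * (t - s) := by
        rw [integral_indicator measurableSet_Ioo, setIntegral_const, smul_eq_mul]; ring

theorem isApprox_numSol (hF : 0 < Finf) (hw : IsState Finf M (u₀, F₀))
    (hR₀ : 0 ≤ R₀) (hbot : ∀ x, x ≤ -R₀ → F₀ x = 0) (htop : ∀ x, R₀ ≤ x → F₀ x = Finf)
    {dx : ℕ → ℝ} (hdx_pos : ∀ k, 0 < dx k) (hdx : Tendsto dx atTop (𝓝 0)) :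
    IsApprox Finf M (fun k => uNum Finf u₀ F₀ (dx k)) (fun k => FNum Finf u₀ F₀ (dx k)) := by
  have hM : 0 ≤ M := (abs_nonneg _).trans (hw.abs_fst_le 0)
  have hts := tendsto_timeStep Finf hdx
  have hp : ∀ k, 0 < timeStep (dx k) Finf := fun k => timeStep_pos (hdx_pos k) hF
  obtain ⟨D, hD⟩ := hts.bddAbove_range
  obtain ⟨D', hD'⟩ := hdx.bddAbove_range
  replace hD : ∀ k, timeStep (dx k) Finf ≤ D := fun k => hD (mem_range_self k)
  replace hD' : ∀ k, dx k ≤ D' := fun k => hD' (mem_range_self k)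
  have hD0 : 0 ≤ D := (hp 0).le.trans (hD 0)
  have hD0' : 0 ≤ D' := (hdx_pos 0).le.trans (hD' 0)
  refine ⟨fun k t ht => isState_numSol (hdx_pos k) hF hw ht, fun T hT => ?_, fun T hT => ?_⟩
  · set V := M + 1 / 4 * Finf * T with hV
    have hV0 : 0 ≤ V := by positivity
    set C₂ := V + 4 * Finf * D with hC₂
    have hC₂0 : 0 ≤ C₂ := by positivity
    -- One constant serves both bounds. The linear term for `u` is absorbed by `t - s ≤ √T √(t -
    -- s)`, with `27/4 = 3 · 9/4`, and subadditivity of the root moves the `Δt` part into `ε`.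
    refine ⟨3 * C₂ + (27 / 4 * Finf * √T + 3 * √(Finf * V)), by positivity,
      fun k => 3 * C₂ * timeStep (dx k) Finf + (27 / 4 * Finf * timeStep (dx k) Finf +
        3 * √(Finf * V * timeStep (dx k) Finf)), ?_, fun k s t hs hst htT => ?_⟩
    · have := (hts.const_mul (3 * C₂)).add ((hts.const_mul (27 / 4 * Finf)).add
        ((hts.const_mul (Finf * V)).sqrt.const_mul 3))
      simpa using this
    obtain ⟨h₁, h₂⟩ := numSol_close (hdx_pos k) hF hw hs hst htT
    rw [← hV] at h₁ h₂
    beta_reduce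
    have hpk := hp k
    have hDk := hD k
    set h := timeStep (dx k) Finf
    have hts : 0 ≤ t - s := sub_nonneg.2 hst
    constructor
    · refine h₁.mono (isState_numSol (hdx_pos k) hF hw hs).energy.monotone ?_
      have a₁ : (V + 4 * Finf * h) * (t - s + h) ≤ C₂ * (t - s + h) := by
        rw [hC₂]; gcongr
      have a₂ : 0 ≤ (27 / 4 * Finf * √T + 3 * √(Finf * V)) * (t - s) := by positivity
      have a₃ : 0 ≤ 27 / 4 * Finf * h + 3 * √(Finf * V * h) := by positivity
      linarith
    · intro x
      refine (h₂ x).trans ?_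
      have a₁ : √(Finf * (V * (t - s + h))) ≤ √(Finf * V) * √(t - s) + √(Finf * V * h) := by
        rw [← Real.sqrt_mul (by positivity)]
        refine le_trans (le_of_eq ?_) (sqrt_add_le_sqrt_add_sqrt (by positivity) (by positivity))
        congr 1; ring
      have a₂ : t - s ≤ √T * √(t - s) := by
        nth_rewrite 1 [← Real.mul_self_sqrt hts]
        gcongr
        linarith
      have a₃ : 27 / 4 * Finf * (t - s) ≤ 27 / 4 * Finf * (√T * √(t - s)) := by gcongr
      have a₄ : 0 ≤ 3 * C₂ * √(t - s) := by positivity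
      have a₅ : 0 ≤ 3 * C₂ * h := by positivity
      linarith
  · refine ⟨R₀ + (D' + 3 * ((M + 1 / 4 * Finf * T + 4 * Finf * D) * (T + D))), by positivity,
      fun k t ht htT => ?_⟩
    have hprof := isProfile_FNum (hdx_pos k) hF hw hbot htop
      (R := R₀ + (D' + 3 * ((M + 1 / 4 * Finf * T + 4 * Finf * D) * (T + D)))) (by
        have := hp k
        gcongr
        · exact hD' k
        · exact hD k
        · exact hD k) ht htT
    exact ⟨hprof.eq_zero, hprof.eq_top⟩

theorem tendsto_uNum_zero (hw : IsState Finf M (u₀, F₀)) {dx : ℕ → ℝ} (hdx_pos : ∀ k, 0 < dx k)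
    (hdx : Tendsto dx atTop (𝓝 0)) (x : ℝ) :
    Tendsto (fun k => uNum Finf u₀ F₀ (dx k) 0 x) atTop (𝓝 (u₀ x)) := by
  have h₁ : Tendsto (fun k => √(Finf * dx k)) atTop (𝓝 0) := by
    simpa using (hdx.const_mul Finf).sqrt
  rw [tendsto_iff_dist_tendsto_zero]
  refine squeeze_zero (fun _ => dist_nonneg) (fun k => ?_) h₁
  rw [Real.dist_eq, uNum, numSol_zero (hdx_pos k)]
  exact hw.abs_proj_sub_le (hdx_pos k) x

/-- The initial projection is within a horizontal shift `Δx` of `F₀`; left continuity of `F₀` closes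
the remaining gap. -/
theorem lowerLimit_FNum_zero (hw : IsState Finf M (u₀, F₀))
    (hleft : ∀ x, ContinuousWithinAt F₀ (Iic x) x) {dx : ℕ → ℝ} (hdx_pos : ∀ k, 0 < dx k)
    (hdx : Tendsto dx atTop (𝓝 0)) : lowerLimit (fun k => FNum Finf u₀ F₀ (dx k) 0) = F₀ := by
  have hz : ∀ k, FNum Finf u₀ F₀ (dx k) 0 = (proj (dx k) (u₀, F₀)).2 := fun k => by
    funext x; rw [FNum, numSol_zero (hdx_pos k)]
  have hG : ∀ k x, FNum Finf u₀ F₀ (dx k) 0 x ∈ Icc 0 Finf := fun k x => by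
    rw [hz]; exact (hw.proj (hdx_pos k)).mem_Icc x
  have hc : ∀ k, GClose (dx k) F₀ (FNum Finf u₀ F₀ (dx k) 0) := fun k => by
    rw [hz]; exact gClose_proj (hdx_pos k) hw.energy.monotone
  have hm : Monotone F₀ := hw.energy.monotone
  funext x
  apply le_antisymm
  · refine lowerLimit_le hG fun y hy c hcc => ?_
    obtain ⟨k, h₁, h₂⟩ := (hcc.and (hdx.eventually (gt_mem_nhds (sub_pos.2 hy)))).exists
    exact h₁.trans (((hc k y).2).trans (hm (by linarith)))
  · have h₁ : Tendsto F₀ (𝓝[<] x) (𝓝 (F₀ x)) :=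
      (hleft x).tendsto.mono_left (nhdsWithin_mono _ Iio_subset_Iic_self)
    refine le_of_tendsto h₁ ?_
    filter_upwards [self_mem_nhdsWithin] with y hy
    obtain ⟨z, hyz, hzx⟩ := exists_between (mem_Iio.1 hy)
    refine le_lowerLimit hG hzx ?_
    filter_upwards [hdx.eventually (gt_mem_nhds (sub_pos.2 hyz))] with k hk
    exact (hm (by linarith)).trans (hc k z).1

end Numerical

/-! ### Bounds from the initial data, and the theorem -/

theorem MemD.exists_abs_le {Finf : ℝ} {u F : ℝ → ℝ} (h : MemD Finf u F) :
    ∃ M, ∀ x, |u x| ≤ M := by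
  refine ⟨(eLpNorm u ∞ volume).toReal, fun x => ?_⟩
  by_contra! hx
  have hopen : IsOpen {y | (eLpNorm u ∞ volume).toReal < |u y|} :=
    isOpen_lt continuous_const h.continuous_u.abs
  have hpos := hopen.measure_pos volume ⟨x, hx⟩
  have hae : ∀ᵐ y, ‖u y‖ₑ ≤ eLpNormEssSup u volume := ae_le_eLpNormEssSup
  refine hpos.ne' (measure_mono_null (t := {y | ¬ ‖u y‖ₑ ≤ eLpNormEssSup u volume})
    (fun y hy hle => ?_) hae)
  rw [← eLpNorm_exponent_top] at hle
  have := ENNReal.toReal_mono h.u_memLp.2.ne hle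
  rw [toReal_enorm, Real.norm_eq_abs] at this
  exact absurd this (not_le.2 hy)

/-- A compactly supported energy measure gives a distribution function that is constant outside
a bounded interval. -/
theorem exists_constant_outside {Finf : ℝ} {F₀ : ℝ → ℝ}
    (hnorm : (eLpNorm F₀ ∞ volume).toReal = Finf) (μ₀ : Measure ℝ) [IsFiniteMeasure μ₀]
    (hμ₀ : ∀ x, F₀ x = (μ₀ (Iio x)).toReal) (hsupp : IsCompact μ₀.support) :
    ∃ R, 0 ≤ R ∧ (∀ x, F₀ x ∈ Icc 0 Finf) ∧ (∀ x, x ≤ -R → F₀ x = 0) ∧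
      ∀ x, R ≤ x → F₀ x = Finf := by
  obtain ⟨r, hr⟩ := hsupp.isBounded.subset_ball 0
  have hnull : ∀ s : Set ℝ, Disjoint s μ₀.support → μ₀ s = 0 := fun s hs =>
    measure_mono_null hs.subset_compl_right Measure.measure_compl_support
  have hball : ∀ y ∈ μ₀.support, |y| < max r 0 := fun y hy => by
    have := hr hy
    rw [mem_ball_zero_iff, Real.norm_eq_abs] at this
    exact this.trans_le (le_max_left _ _)
  have hbot : ∀ x, x ≤ -max r 0 → F₀ x = 0 := fun x hx => by
    rw [hμ₀, hnull, ENNReal.toReal_zero]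
    refine disjoint_left.2 fun y hy hy' => ?_
    have := abs_lt.1 (hball y hy')
    linarith [this.1, mem_Iio.1 hy]
  have htop : ∀ x, max r 0 ≤ x → F₀ x = (μ₀ univ).toReal := fun x hx => by
    have h₁ : μ₀ (Iio x)ᶜ = 0 := hnull _ (disjoint_left.2 fun y hy hy' => by
      have := abs_lt.1 (hball y hy')
      rw [compl_Iio, mem_Ici] at hy
      linarith [this.2])
    rw [hμ₀, measure_of_measure_compl_eq_zero h₁]
  have hIcc : ∀ x, F₀ x ∈ Icc 0 (μ₀ univ).toReal := fun x => by
    rw [hμ₀]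
    exact ⟨ENNReal.toReal_nonneg, ENNReal.toReal_mono (measure_ne_top _ _)
      (measure_mono (subset_univ _))⟩
  -- The essential supremum of `F₀` is attained on a half-line, which identifies the total mass with
  -- `Finf`.
  have hFinf : (μ₀ univ).toReal = Finf := (toReal_eLpNorm_top_eq hIcc htop).symm.trans hnorm
  rw [hFinf] at hIcc htop
  exact ⟨max r 0, le_max_right _ _, hIcc, hbot, htop⟩

end HunterSaxton

theorem mainTheorem1 (Finf : ℝ) (hFinf : 0 < Finf) (u₀ F₀ : ℝ → ℝ) (h₀ : HunterSaxton.MemD Finf u₀ F₀)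
    (μ₀ : Measure ℝ) [IsFiniteMeasure μ₀] (hμ₀ : ∀ x, F₀ x = (μ₀ (Iio x)).toReal)
    (hsupp : IsCompact μ₀.support)
    (dx : ℕ → ℝ) (hdx_pos : ∀ k, 0 < dx k) (hdx : Tendsto dx atTop (𝓝 0)) :
    ∃ (σ : ℕ → ℕ) (u F : ℝ → ℝ → ℝ), StrictMono σ ∧
      -- uniform convergence of `u_Δx` and convergence of `F_Δx` in `C([0,T], L¹)`
      (∀ T : ℝ, 0 < T →
        TendstoUniformlyOn (fun k (p : ℝ × ℝ) => HunterSaxton.uNum Finf u₀ F₀ (dx (σ k)) p.1 p.2)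
          (fun p => u p.1 p.2) atTop (Icc 0 T ×ˢ univ) ∧
        HunterSaxton.TendstoCL1 T (fun k => HunterSaxton.FNum Finf u₀ F₀ (dx (σ k))) F) ∧
      -- pointwise a.e. convergence of `F_Δx`
      (∀ t : ℝ, 0 ≤ t →
        ∀ᵐ x, Tendsto (fun k => HunterSaxton.FNum Finf u₀ F₀ (dx (σ k)) t x) atTop (𝓝 (F t x))) ∧
      -- initial data
      u 0 = u₀ ∧ F 0 = F₀ ∧
      -- `u ∈ C^{0,1/2}([0,T] × ℝ)`
      (∀ T : ℝ, 0 < T →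
        (∃ M : ℝ, ∀ t ∈ Icc 0 T, ∀ x, |u t x| ≤ M) ∧
        ∃ C : ℝ≥0, HolderOnWith C (1 / 2) (fun p : ℝ × ℝ => u p.1 p.2) (Icc 0 T ×ˢ univ)) ∧
      (∀ t : ℝ, 0 ≤ t → HunterSaxton.MemD Finf (u t) (F t)) ∧
      (∀ t : ℝ, 0 ≤ t → (eLpNorm (F t) ∞ volume).toReal = Finf) := by
  obtain ⟨M, hM⟩ := h₀.exists_abs_le
  obtain ⟨R₀, hR₀, hIcc, hbot, htop⟩ := HunterSaxton.exists_constant_outside h₀.F_norm μ₀ hμ₀ hsupp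
  have hw : HunterSaxton.IsState Finf M (u₀, F₀) := ⟨h₀.energyPair, hIcc, hM⟩
  obtain ⟨σ, hσ, hconv⟩ :=
    (HunterSaxton.isApprox_numSol hFinf hw hR₀ hbot htop hdx_pos hdx).exists_subseq
  have hpos : ∀ k, 0 < dx (σ k) := fun k => hdx_pos _
  have hlim : Tendsto (fun k => dx (σ k)) atTop (𝓝 0) := hdx.comp hσ.tendsto_atTop
  -- The compactness hypotheses are established again for the extracted mesh sizes, so that all
  -- limits run along the subsequence.
  have hA := HunterSaxton.isApprox_numSol hFinf hw hR₀ hbot htop hpos hlim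
  have hconvF : ∀ q r : ℚ, 0 ≤ q →
      ∃ l, Tendsto (fun k => HunterSaxton.FNum Finf u₀ F₀ (dx (σ k)) q r) atTop (𝓝 l) :=
    fun q r hq => (hconv q r hq).2
  obtain ⟨v, hv⟩ := hA.exists_u_limit fun q r hq => (hconv q r hq).1
  have hmem := fun t ht => hA.memD_limit hv (t := t) ht
  refine ⟨σ, v, fun t => HunterSaxton.lowerLimit fun k => HunterSaxton.FNum Finf u₀ F₀ (dx (σ k)) t,
    hσ, fun T hT => ⟨?_, ?_⟩, fun t ht => ?_, ?_, ?_, fun T hT => ⟨⟨M + 1 / 4 * Finf * T, fun t ht x => ?_⟩, ?_⟩, hmem,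
    fun t ht => (hmem t ht).F_norm⟩
  · exact hA.tendstoUniformlyOn hv hT
  · exact hA.tendstoCL1 hconvF hT fun k => HunterSaxton.contL1_FNum (hpos k) hFinf hw hbot htop T
  · exact hA.ae_tendsto hconvF ht
  · funext x
    exact tendsto_nhds_unique (hv 0 le_rfl x) (HunterSaxton.tendsto_uNum_zero hw hpos hlim x)
  · exact HunterSaxton.lowerLimit_FNum_zero hw h₀.F_leftCont hpos hlim
  · refine (hA.abs_limit_le hv ht.1 x).trans ?_
    have := ht.2
    gcongr
  · exact hA.holderOnWith hv hT
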